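/- Let $\mathcal D$ be a triangulated category, $\Lambda$ a free abelian group of finite rank and $p\colon K(\mathcal D)\to\Lambda$ a surjection. Let $\mathrm{Stab}(\mathcal D)$ be the space, with Bridgeland's topology, of locally finite Bridgeland stability conditions $\sigma=(Z,\mathcal P)$ on $\mathcal D$ whose central charge factors through $p$. Equip it with the geodesic (extended) distance $\tilde d$ of the Riemannian metric pulled back along $(Z,\mathcal P)\mapsto Z$ from a constant metric on $\mathrm{Hom}(\Lambda,\mathbb C)$ given by a real inner product: $\tilde d(\sigma,\tau)$ is the infimum of the lengths of the central charge along the continuous paths from $\sigma$ to $\tau$ in $\mathrm{Stab}(\mathcal D)$ whose central charge is $C^1$. Let $\sigma_n=(Z_n,\mathcal P_n)$ be a Cauchy sequence in $(\mathrm{Stab}(\mathcal D),\tilde d)$. Let $m_{\sigma_n}(E)$ be the mass of $E$, that is, the sum of the $|Z_n|$ of its Harder–Narasimhan factors, and let $\phi_n^{\pm}(E)$ be the maximal and minimal phases of $E$ with respect to $\mathcal P_n$. Define full subcategories of $\mathcal D$ by $$\mathcal K_\sigma=\{E : m_{\sigma_n}(E)\to 0\},\qquad \mathcal P_\infty(\phi)=\{E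 : E=0 \text{ or } \phi_n^{\pm}(E)\to\phi\},$$ and let $\mathcal A=\mathcal P_\infty((0,1])$ be the full subcategory of the objects $E$ that admit a Harder–Narasimhan filtration with factors in $\mathcal P_\infty(\phi_1),\dots,\mathcal P_\infty(\phi_k)$, where $1\ge\phi_1>\dots>\phi_k>0$. Then: 1. If $E\to F\to G\to E[1]$ is a distinguished triangle with $E,F,G\in\mathcal A$, then $F\in\mathcal K_\sigma$ if and only if $E\in\mathcal K_\sigma$ and $G\in\mathcal K_\sigma$. 2. If $\mathcal P_\infty$ is a slicing of $\mathcal D$, then $\mathcal A$ is the heart of a bounded t-structure on $\mathcal D$. 3. $\mathcal K_\sigma$ is a triangulated subcategory of $\mathcal D$. Whenever $\mathcal A$ is the heart of a bounded t-structure $(\mathcal D^{\le n},\mathcal D^{\ge n})_{n\in\mathbb Z}$ on $\mathcal D$, the category $\mathcal A$ is abelian, $\mathcal A\cap\mathcal K_\sigma$ is a Serre subcategory of $\mathcal A$, and the t-structure descends to the Verdier quotient $\mathcal D/\mathcal K_\sigma$: the essential images of $\mathcal D^{\le n}$ and $\mathcal D^{\ge n}$ under the quotient functor form a bounded t-structure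 on $\mathcal D/\mathcal K_\sigma$, whose heart is the essential image of $\mathcal A$. -/

import Mathlib

open CategoryTheory Limits Pretriangulated Triangulated Filter Topology
open scoped ENNReal

universe v u w

namespace DegStab

noncomputable section

section Categories

variable (C : Type u) [Category.{v} C] [Preadditive C] [HasZeroObject C] [HasShift C ℤ]
  [∀ n : ℤ, (shiftFunctor C n).Additive] [Pretriangulated C]

/-- The relations `[Y] = [X] + [Z]`, one for each distinguished triangle `X ⟶ Y ⟶ Z ⟶ X⟦1⟧`. -/
def triangleRelations : Set (FreeAbelianGroup C) :=
  {x | ∃ T ∈ distTriang C,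
    x = FreeAbelianGroup.of T.obj₂ - FreeAbelianGroup.of T.obj₁ - FreeAbelianGroup.of T.obj₃}

/-- The Grothendieck group `K(C)` of a triangulated category. -/
abbrev GrothendieckGroup : Type u :=
  FreeAbelianGroup C ⧸ AddSubgroup.closure (triangleRelations C)

variable {C}

/-- The class `[E]` of an object in the Grothendieck group. -/
def classOf (E : C) : GrothendieckGroup C :=
  QuotientAddGroup.mk (FreeAbelianGroup.of E)

/-- A Harder-Narasimhan filtration of `E` with respect to a family `P` of full subcategories
indexed by phases: a chain `0 = E₀ ⟶ E₁ ⟶ ⋯ ⟶ Eₙ = E` whose successive cones are nonzero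
objects of `P φ₁, …, P φₙ` with `φ₁ > ⋯ > φₙ`. The zero object has the filtration of length `0`. -/
structure HNFiltration (P : ℝ → ObjectProperty C) (E : C) where
  length : ℕ
  obj : Fin (length + 1) → C
  isZero_bot : IsZero (obj 0)
  topIso : obj (Fin.last length) ≅ E
  factor : Fin length → C
  phase : Fin length → ℝ
  strictAnti : StrictAnti phase
  mem : ∀ i, P (phase i) (factor i)
  nonzero : ∀ i, ¬ IsZero (factor i)
  incl : ∀ i : Fin length, obj i.castSucc ⟶ obj i.succ
  proj : ∀ i : Fin length, obj i.succ ⟶ factor i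
  conn : ∀ i : Fin length, factor i ⟶ (obj i.castSucc)⟦(1 : ℤ)⟧
  distinguished : ∀ i, Triangle.mk (incl i) (proj i) (conn i) ∈ distTriang C

/-- For a set `I` of phases, the full subcategory `P(I)` of the objects all of whose
Harder-Narasimhan phases lie in `I`. -/
def phaseInterval (P : ℝ → ObjectProperty C) (I : Set ℝ) : ObjectProperty C :=
  fun E => ∃ F : HNFiltration P E, ∀ i, F.phase i ∈ I

variable (C) in
/-- A slicing of a triangulated category. -/
structure Slicing where
  P : ℝ → ObjectProperty C
  isClosedUnderIsomorphisms : ∀ φ, (P φ).IsClosedUnderIsomorphisms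
  zero_mem : ∀ φ (E : C), IsZero E → P φ E
  biprod_mem : ∀ φ (X Y : C) (b : BinaryBicone X Y), b.IsBilimit → P φ X → P φ Y → P φ b.pt
  shift_iff : ∀ φ (E : C), P (φ + 1) (E⟦(1 : ℤ)⟧) ↔ P φ E
  hom_eq_zero : ∀ φ₁ φ₂, φ₂ < φ₁ → ∀ (E F : C) (f : E ⟶ F), P φ₁ E → P φ₂ F → f = 0
  exists_hn : ∀ E : C, Nonempty (HNFiltration P E)

namespace Slicing

/-- The Harder-Narasimhan filtration of an object; it is unique up to unique isomorphism. -/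
def hn (S : Slicing C) (E : C) : HNFiltration S.P E := (S.exists_hn E).some

/-- The maximal phase `φ⁺(E)`: the largest of the finitely many phases of `E ≠ 0`. -/
def phiPlus (S : Slicing C) (E : C) : ℝ := ⨆ i, (S.hn E).phase i

/-- The minimal phase `φ⁻(E)`: the smallest of the finitely many phases of `E ≠ 0`. -/
def phiMinus (S : Slicing C) (E : C) : ℝ := ⨅ i, (S.hn E).phase i

/-- The generalized metric on slicings. -/
def slicingDist (S T : Slicing C) : ℝ≥0∞ :=
  ⨆ (E : C) (_ : ¬ IsZero E),
    max (ENNReal.ofReal |S.phiPlus E - T.phiPlus E|)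
      (ENNReal.ofReal |S.phiMinus E - T.phiMinus E|)

end Slicing

/-- A morphism of the full subcategory `A` is a strict monomorphism if it is the first morphism
of a distinguished triangle with all vertices in `A`. -/
def IsStrictMono (A : ObjectProperty C) {X Y : C} (f : X ⟶ Y) : Prop :=
  A X ∧ A Y ∧ ∃ (Z : C) (q : Y ⟶ Z) (d : Z ⟶ X⟦(1 : ℤ)⟧),
    A Z ∧ Triangle.mk f q d ∈ distTriang C

/-- The full subcategory `A` (in practice `P((a, b))` with `b - a ≤ 1`, which is quasi-abelian)
has finite length: descending and ascending chains of strict subobjects of an object of `A`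
become stationary. -/
def IsFiniteLength (A : ObjectProperty C) : Prop :=
  ∀ E : C, A E → ∀ (X : ℕ → C) (i : ∀ k, X k ⟶ E), (∀ k, IsStrictMono A (i k)) →
    (∀ j : ∀ k, X (k + 1) ⟶ X k, (∀ k, j k ≫ i k = i (k + 1)) →
      ∃ N, ∀ k ≥ N, IsIso (j k)) ∧
    (∀ j : ∀ k, X k ⟶ X (k + 1), (∀ k, j k ≫ i (k + 1) = i k) →
      ∃ N, ∀ k ≥ N, IsIso (j k))

end Categories

section Stability

variable {C : Type u} [Category.{v} C] [Preadditive C] [HasZeroObject C] [HasShift C ℤ]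
  [∀ n : ℤ, (shiftFunctor C n).Additive] [Pretriangulated C]
  {Λ : Type w} [AddCommGroup Λ]

/-- `Stab(C)`: locally finite Bridgeland stability conditions on `C` whose central charge factors
through `p : K(C) → Λ`. The field `Z` is the induced homomorphism on `Λ`, so the central charge of
an object `E` is `Z (p [E])`. -/
structure StabilityCondition (p : GrothendieckGroup C →+ Λ) where
  slicing : Slicing C
  Z : Λ →+ ℂ
  compatible : ∀ (φ : ℝ) (E : C), slicing.P φ E → ¬ IsZero E →
    ∃ r : ℝ, 0 < r ∧ Z (p (classOf E)) = r * Complex.exp (Complex.I * Real.pi * φ)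
  locallyFinite : ∃ η : ℝ, 0 < η ∧ η < 1 / 2 ∧
    ∀ φ : ℝ, IsFiniteLength (phaseInterval slicing.P (Set.Ioo (φ - η) (φ + η)))

variable {p : GrothendieckGroup C →+ Λ}

namespace StabilityCondition

/-- The mass `m_σ(E)`: the sum of the `|Z|` of the Harder-Narasimhan factors of `E`. -/
def mass (σ : StabilityCondition p) (E : C) : ℝ :=
  ∑ i, ‖σ.Z (p (classOf ((σ.slicing.hn E).factor i)))‖

/-- The generalized norm `‖U‖_σ = sup |U(E)| / |Z(E)|` over the nonzero `σ`-semistable `E`. -/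
def chargeNorm (σ : StabilityCondition p) (U : Λ →+ ℂ) : ℝ≥0∞ :=
  ⨆ (φ : ℝ) (E : C) (_ : σ.slicing.P φ E) (_ : ¬ IsZero E),
    ENNReal.ofReal (‖U (p (classOf E))‖ / ‖σ.Z (p (classOf E))‖)

/-- The basic neighbourhood `B_ε(σ)`. -/
def basicBall (σ : StabilityCondition p) (ε : ℝ) : Set (StabilityCondition p) :=
  {τ | σ.chargeNorm (τ.Z - σ.Z) < ENNReal.ofReal (Real.sin ε) ∧
    σ.slicing.slicingDist τ.slicing < ENNReal.ofReal ε}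

/-- Bridgeland's topology on `Stab(C)`, with basis the `B_ε(σ)` for small `ε`. -/
instance : TopologicalSpace (StabilityCondition p) :=
  TopologicalSpace.generateFrom
    {U | ∃ (σ : StabilityCondition p) (ε : ℝ), 0 < ε ∧ ε < 1 / 4 ∧ U = σ.basicBall ε}

/-- The geodesic distance on `Stab(C)` of the pullback, along the forgetful map `σ ↦ Z`, of the
constant Riemannian metric on `Hom(Λ, ℂ)` given by the real inner product `g`: the infimum of the
`g`-lengths of the central charge along continuous paths in `Stab(C)` with `C¹` central charge. -/
def geodesicDist (g : InnerProductSpace.Core ℝ (Λ →+ ℂ)) (σ τ : StabilityCondition p) : ℝ≥0∞ :=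
  letI : NormedAddCommGroup (Λ →+ ℂ) := g.toNormedAddCommGroup
  letI : InnerProductSpace ℝ (Λ →+ ℂ) := InnerProductSpace.ofCore g.toCore
  ⨅ (γ : ℝ → StabilityCondition p) (_ : ContinuousOn γ (Set.Icc 0 1)) (_ : γ 0 = σ) (_ : γ 1 = τ)
    (_ : ContDiffOn ℝ 1 (fun t => (γ t).Z) (Set.Icc 0 1)),
    ∫⁻ t in Set.Icc (0 : ℝ) 1, ‖derivWithin (fun t => (γ t).Z) (Set.Icc 0 1) t‖ₑ

end StabilityCondition

/-- Cauchy sequences in `Stab(C)` for the geodesic distance of the pullback metric. -/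
def IsCauchySequence (g : InnerProductSpace.Core ℝ (Λ →+ ℂ)) (σ : ℕ → StabilityCondition p) :
    Prop :=
  ∀ ε : ℝ≥0∞, 0 < ε → ∃ N, ∀ m ≥ N, ∀ n ≥ N, (σ m).geodesicDist g (σ n) < ε

/-- The full subcategory `K_σ` of the objects whose mass tends to zero. -/
def massless (σ : ℕ → StabilityCondition p) : ObjectProperty C :=
  fun E => Tendsto (fun n => (σ n).mass E) atTop (𝓝 0)

/-- The full subcategories `P_∞(φ)` of the objects all of whose phases tend to `φ`. The zero object,
which has no phases, belongs to all of them. -/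
def limitPhase (σ : ℕ → StabilityCondition p) (φ : ℝ) : ObjectProperty C :=
  fun E => IsZero E ∨
    (Tendsto (fun n => (σ n).slicing.phiPlus E) atTop (𝓝 φ) ∧
      Tendsto (fun n => (σ n).slicing.phiMinus E) atTop (𝓝 φ))

/-- The limiting heart `A = P_∞((0, 1])`. -/
def limitHeart (σ : ℕ → StabilityCondition p) : ObjectProperty C :=
  phaseInterval (limitPhase σ) (Set.Ioc 0 1)

end Stability

section Descent

variable {C : Type u} [Category.{v} C] [Preadditive C] [HasZeroObject C] [HasShift C ℤ]
  [∀ n : ℤ, (shiftFunctor C n).Additive] [Pretriangulated C]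

/-- A t-structure is bounded if every object is bounded above and below. -/
def IsBoundedTStructure (t : TStructure C) : Prop := ∀ E : C, t.bounded E

variable [IsTriangulated C]

/-- The Verdier quotient `C/K`: the localization of `C` at the morphisms with cone in `K`, with its
triangulated structure. -/
abbrev VerdierQuotient (K : ObjectProperty C) [K.IsTriangulated] : Type _ := K.trW.Localization

/-- The t-structure `t` on `C` descends to the t-structure `t'` on `C/K`: the subcategories defining
`t'` are the essential images of those defining `t` under the quotient functor. -/
def DescendsTo (t : TStructure C) (K : ObjectProperty C) [K.IsTriangulated]
    (t' : TStructure (VerdierQuotient K)) : Prop :=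
  ∀ n : ℤ, t'.le n = (t.le n).map K.trW.Q ∧ t'.ge n = (t.ge n).map K.trW.Q

end Descent

end

end DegStab

/-!
For a stability condition `(Z, P)` and a real `a`, the imaginary part of `exp(-iπa) Z` is additive
on the Grothendieck group and nonnegative on the heart `P((a, a + 1])`. The alternating long exact
cohomology sequence for this heart makes its absolute value, summed over the cohomology objects,
subadditive on distinguished triangles; this sum equals the sum of `|Im (exp(-iπa) Z)|` over the
Harder-Narasimhan factors. Adding the values for `a` and `a + 1/2` recovers the mass up to a factor
`2`, so masses are subadditive up to that factor, whence `K_σ` is triangulated.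

An object of `A` lies in `P_n([2δ, 1 + δ])` for all small `δ > 0` and all large `n`, so after
rotating by `3δ/2` all of its phases stay away from the boundary of the half plane, and its mass is
at most a constant times an additive function: hence the statements about triangles in `A`. If the
ends of a triangle are the truncations of its middle term for a bounded t-structure with heart `A`,
their phases can overlap only in an arbitrarily small interval, and rotating by an angle away from
it bounds their masses by that of the middle term. So `K_σ` is stable under truncation, and together
with the Serre property this makes the t-structure descend to the quotient.
-/

namespace DegStab

open scoped ZeroObject

variable {C : Type u} [Category.{v} C] [Preadditive C] [HasZeroObject C] [HasShift C ℤ]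
  [∀ n : ℤ, (shiftFunctor C n).Additive] [Pretriangulated C]

section Extensions

/-- `Y` is an extension of `Z` by `X`: there is a distinguished triangle `X ⟶ Y ⟶ Z ⟶ X⟦1⟧`.
Only the existence of the morphisms is recorded. -/
def IsExtension (X Y Z : C) : Prop :=
  ∃ (f : X ⟶ Y) (g : Y ⟶ Z) (h : Z ⟶ X⟦(1 : ℤ)⟧), Triangle.mk f g h ∈ distTriang C

namespace IsExtension

lemma of_distTriang {T : Triangle C} (hT : T ∈ distTriang C) :
    IsExtension T.obj₁ T.obj₂ T.obj₃ :=
  ⟨T.mor₁, T.mor₂, T.mor₃, hT⟩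

lemma of_isZero_left {X Y Z : C} (hX : IsZero X) (e : Y ≅ Z) : IsExtension X Y Z :=
  ⟨0, e.hom, 0, (Triangle.distinguished_iff_of_isZero₁ (Triangle.mk _ _ _) hX).2
    (inferInstanceAs (IsIso e.hom))⟩

lemma of_isZero_right {X Y Z : C} (hZ : IsZero Z) (e : X ≅ Y) : IsExtension X Y Z :=
  ⟨e.hom, 0, 0, (Triangle.distinguished_iff_of_isZero₃ (Triangle.mk _ _ _) hZ).2
    (inferInstanceAs (IsIso e.hom))⟩

variable {X Y Z : C} (h : IsExtension X Y Z)
include h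

lemma rotate : IsExtension Y Z (X⟦(1 : ℤ)⟧) :=
  let ⟨_, _, _, hT⟩ := h
  .of_distTriang (rot_of_distTriang _ hT)

lemma invRotate : IsExtension (Z⟦(-1 : ℤ)⟧) X Y :=
  let ⟨_, _, _, hT⟩ := h
  .of_distTriang (inv_rot_of_distTriang _ hT)

lemma shift (n : ℤ) : IsExtension (X⟦n⟧) (Y⟦n⟧) (Z⟦n⟧) :=
  let ⟨_, _, _, hT⟩ := h
  .of_distTriang (Triangle.shift_distinguished _ hT n)

lemma nonempty_iso_of_isZero_left (hX : IsZero X) : Nonempty (Y ≅ Z) :=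
  let ⟨_, g, _, hT⟩ := h
  have : IsIso g := (Triangle.isZero₁_iff_isIso₂ _ hT).1 hX
  ⟨asIso g⟩

lemma congr {X' Y' Z' : C} (e₁ : X ≅ X') (e₂ : Y ≅ Y') (e₃ : Z ≅ Z') :
    IsExtension X' Y' Z' := by
  obtain ⟨f, g, h, hT⟩ := h
  refine ⟨e₁.inv ≫ f ≫ e₂.hom, e₂.inv ≫ g ≫ e₃.hom, e₃.inv ≫ h ≫ e₁.hom⟦(1 : ℤ)⟧',
    isomorphic_distinguished _ hT _ (Triangle.isoMk _ _ e₁.symm e₂.symm e₃.symm ?_ ?_ ?_)⟩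
  · change (e₁.inv ≫ f ≫ e₂.hom) ≫ e₂.inv = e₁.inv ≫ f
    simp
  · change (e₂.inv ≫ g ≫ e₃.hom) ≫ e₃.inv = e₂.inv ≫ g
    simp
  · change (e₃.inv ≫ h ≫ e₁.hom⟦(1 : ℤ)⟧') ≫ e₁.inv⟦(1 : ℤ)⟧' = e₃.inv ≫ h
    simp

variable [IsTriangulated C]

lemma exists_cone_comp {V B : C} (h' : IsExtension Y V B) :
    ∃ D, IsExtension X V D ∧ IsExtension Z D B := by
  obtain ⟨f, g, h, hT⟩ := h
  obtain ⟨f', g', h', hT'⟩ := h'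
  obtain ⟨D, p, q, hD⟩ := distinguished_cocone_triangle (f ≫ f')
  exact ⟨D, .of_distTriang hD, .of_distTriang (someOctahedron rfl hT hT' hD).mem⟩

lemma exists_fiber_comp {V B : C} (h' : IsExtension B Z V) :
    ∃ D, IsExtension D Y V ∧ IsExtension X D B := by
  obtain ⟨f, g, h, hT⟩ := h
  obtain ⟨f', g', h', hT'⟩ := h'
  obtain ⟨D, p, q, hD⟩ := distinguished_cocone_triangle₁ (g ≫ g')
  exact ⟨D, .of_distTriang hD, .of_distTriang (someOctahedron' rfl hT hT' hD).mem⟩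

end IsExtension

end Extensions

section GrothendieckGroup

lemma IsExtension.classOf_eq_add {X Y Z : C} (h : IsExtension X Y Z) :
    classOf Y = classOf X + classOf Z := by
  obtain ⟨f, g, h, hT⟩ := h
  rw [classOf, classOf, classOf, ← QuotientAddGroup.mk_add, eq_comm, QuotientAddGroup.eq]
  exact AddSubgroup.subset_closure ⟨_, hT, by simp only [Triangle.mk]; abel⟩

lemma classOf_eq_zero {X : C} (hX : IsZero X) : classOf X = 0 := by
  simpa using (IsExtension.of_isZero_left hX (Iso.refl X)).classOf_eq_add

lemma classOf_eq_of_iso {X Y : C} (e : X ≅ Y) : classOf X = classOf Y := by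
  simpa [classOf_eq_zero (isZero_zero C)] using
    (IsExtension.of_isZero_left (isZero_zero C) e).classOf_eq_add

lemma classOf_shift (X : C) (n : ℤ) : classOf (X⟦n⟧) = n.negOnePow • classOf X := by
  have succ (Y : C) : classOf (Y⟦(1 : ℤ)⟧) = -classOf Y := by
    have := (IsExtension.of_distTriang (contractible_distinguished Y)).rotate.classOf_eq_add
    exact (neg_eq_of_add_eq_zero_right
      (this.symm.trans (classOf_eq_zero (isZero_zero C)))).symm
  have add_one (m : ℤ) : classOf (X⟦m + 1⟧) = -classOf (X⟦m⟧) :=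
    (classOf_eq_of_iso ((shiftFunctorAdd' C m 1 (m + 1) rfl).app X)).trans (succ _)
  induction n using Int.induction_on with
  | zero => simpa using classOf_eq_of_iso ((shiftFunctorZero C ℤ).app X)
  | succ n ih => rw [add_one, ih, Int.negOnePow_succ, Units.neg_smul]
  | pred n ih =>
    have := add_one (-n - 1)
    rw [sub_add_cancel, ih] at this
    rw [Int.negOnePow_sub, Int.negOnePow_one, mul_neg, mul_one, Units.neg_smul, this, neg_neg]

end GrothendieckGroup

section ExtensionClosure

/-- The extension closure of `P`: the smallest full subcategory containing the zero objects and the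
objects satisfying `P`, and closed under extensions. -/
inductive ExtensionClosure (P : ObjectProperty C) : ObjectProperty C
  | of_isZero {X : C} : IsZero X → ExtensionClosure P X
  | of_mem {X : C} : P X → ExtensionClosure P X
  | extension {X Y Z : C} :
      IsExtension X Y Z → ExtensionClosure P X → ExtensionClosure P Z → ExtensionClosure P Y

namespace ExtensionClosure

variable {P Q : ObjectProperty C}

lemma of_iso {X Y : C} (h : ExtensionClosure P X) (e : X ≅ Y) : ExtensionClosure P Y :=
  .extension (.of_isZero_right (isZero_zero C) e) h (.of_isZero (isZero_zero C))

instance : (ExtensionClosure P).ContainsZero :=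
  ⟨⟨0, isZero_zero C, .of_isZero (isZero_zero C)⟩⟩

instance : (ExtensionClosure P).IsClosedUnderIsomorphisms := ⟨fun e h ↦ h.of_iso e⟩

instance : (ExtensionClosure P).IsTriangulatedClosed₂ :=
  .mk' fun _ hT h₁ h₃ ↦ .extension (.of_distTriang hT) h₁ h₃

lemma le [Q.ContainsZero] [Q.IsClosedUnderIsomorphisms] [Q.IsTriangulatedClosed₂] (h : P ≤ Q) :
    ExtensionClosure P ≤ Q := fun X hX ↦ by
  induction hX with
  | of_isZero hX => exact Q.prop_of_isZero hX
  | of_mem hX => exact h _ hX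
  | extension hT _ _ hX hZ =>
    obtain ⟨_, _, _, hT⟩ := hT
    exact Q.ext_of_isTriangulatedClosed₂ _ hT hX hZ

lemma mono (h : P ≤ Q) : ExtensionClosure P ≤ ExtensionClosure Q := fun X hX ↦ by
  induction hX with
  | of_isZero hX => exact .of_isZero hX
  | of_mem hX => exact .of_mem (h _ hX)
  | extension hT _ _ hX hZ => exact .extension hT hX hZ

lemma shift (n : ℤ) (h : ∀ X, P X → Q (X⟦n⟧)) {X : C} (hX : ExtensionClosure P X) :
    ExtensionClosure Q (X⟦n⟧) := by
  induction hX with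
  | of_isZero hX => exact .of_isZero ((shiftFunctor C n).map_isZero hX)
  | of_mem hX => exact .of_mem (h _ hX)
  | extension hT _ _ hX hZ => exact .extension (hT.shift n) hX hZ

lemma hom_eq_zero (h : P ≤ Q.leftOrthogonal) {X Y : C} (hX : ExtensionClosure P X)
    (hY : ExtensionClosure Q Y) (f : X ⟶ Y) : f = 0 :=
  have hP : P ≤ (ExtensionClosure Q).leftOrthogonal := fun _ hX _ f hY ↦
    le (Q := P.rightOrthogonal) (fun _ hY _ f hX ↦ h _ hX f hY) _ hY f hX
  le hP _ hX f hY

end ExtensionClosure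

end ExtensionClosure

section Truncations

variable {t : TStructure C}

namespace IsExtension

lemma isLE_mid {X Y Z : C} (h : IsExtension X Y Z) {n : ℤ} (hX : t.IsLE X n)
    (hZ : t.IsLE Z n) : t.IsLE Y n :=
  let ⟨_, _, _, hT⟩ := h
  t.isLE₂ _ hT n hX hZ

lemma isGE_mid {X Y Z : C} (h : IsExtension X Y Z) {n : ℤ} (hX : t.IsGE X n)
    (hZ : t.IsGE Z n) : t.IsGE Y n :=
  let ⟨_, _, _, hT⟩ := h
  t.isGE₂ _ hT n hX hZ

lemma isLE_right {X Y Z : C} (h : IsExtension X Y Z) {n : ℤ} (hX : t.IsLE X (n + 1))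
    (hY : t.IsLE Y n) : t.IsLE Z n :=
  h.rotate.isLE_mid hY (t.isLE_shift X (n + 1) 1 n)

lemma isGE_left {X Y Z : C} (h : IsExtension X Y Z) {n : ℤ} (hY : t.IsGE Y n)
    (hZ : t.IsGE Z (n - 1)) : t.IsGE X n :=
  h.invRotate.isGE_mid (t.isGE_shift Z (n - 1) (-1) n) hY

end IsExtension

variable (t) in
lemma isExtension_trunc (X : C) (n : ℤ) :
    IsExtension ((t.truncLT n).obj X) X ((t.truncGE n).obj X) :=
  .of_distTriang (t.triangleLTGE_distinguished n X)

lemma prop_of_isGE_of_isLE [IsTriangulated C] {Q : ObjectProperty C} [Q.ContainsZero]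
    [Q.IsClosedUnderIsomorphisms] [Q.IsTriangulatedClosed₂] {a b : ℤ}
    (h : ∀ k, a ≤ k → k ≤ b → ∀ Z, t.IsLE Z k → t.IsGE Z k → Q Z) {X : C} (hX : t.IsGE X a)
    (hX' : t.IsLE X b) : Q X := by
  rcases lt_or_ge b a with hab | hab
  · exact Q.prop_of_isZero (t.isZero X b a hab)
  · have hLT : Q ((t.truncLT b).obj X) :=
      prop_of_isGE_of_isLE (b := b - 1) (fun k hk hk' ↦ h k hk (by lia)) inferInstance
        inferInstance
    have hGE : Q ((t.truncGE b).obj X) := h b hab le_rfl _ inferInstance inferInstance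
    exact Q.ext_of_isTriangulatedClosed₂ _ (t.triangleLTGE_distinguished b X) hLT hGE
termination_by (b - a + 1).toNat

namespace IsExtension

variable {X Y Z : C} (h : IsExtension X Y Z)
include h

lemma nonempty_iso_trunc {n : ℤ} (hX : t.IsLE X (n - 1)) (hZ : t.IsGE Z n) :
    Nonempty (X ≅ (t.truncLT n).obj Y) ∧ Nonempty (Z ≅ (t.truncGE n).obj Y) := by
  obtain ⟨f, g, h, hT⟩ := h
  obtain ⟨e, -⟩ := t.triangle_iso_exists hT (t.triangleLTGE_distinguished n Y) (Iso.refl _)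
    (n - 1) n hX hZ inferInstance inferInstance
  exact ⟨⟨Triangle.π₁.mapIso e⟩, ⟨Triangle.π₃.mapIso e⟩⟩

variable [IsTriangulated C]

lemma truncLT_of_isLE_left {n : ℤ} (hX : t.IsLE X (n - 1)) :
    IsExtension X ((t.truncLT n).obj Y) ((t.truncLT n).obj Z) := by
  obtain ⟨D, hD, hXD⟩ := h.exists_fiber_comp (isExtension_trunc t Z n)
  obtain ⟨⟨e⟩, -⟩ := hD.nonempty_iso_trunc (hXD.isLE_mid hX inferInstance) inferInstance
  exact hXD.congr (.refl _) e (.refl _)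

lemma nonempty_truncGE_iso_of_isLE_left {n : ℤ} (hX : t.IsLE X (n - 1)) :
    Nonempty ((t.truncGE n).obj Z ≅ (t.truncGE n).obj Y) := by
  obtain ⟨D, hD, hXD⟩ := h.exists_fiber_comp (isExtension_trunc t Z n)
  exact (hD.nonempty_iso_trunc (hXD.isLE_mid hX inferInstance) inferInstance).2

lemma nonempty_truncLT_iso_of_isGE_right {n : ℤ} (hZ : t.IsGE Z n) :
    Nonempty ((t.truncLT n).obj X ≅ (t.truncLT n).obj Y) := by
  obtain ⟨D, hD, hDZ⟩ := (isExtension_trunc t X n).exists_cone_comp h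
  exact (hD.nonempty_iso_trunc inferInstance (hDZ.isGE_mid inferInstance hZ)).1

/-- The object `I` is the image, in degree `n - 1`, of the connecting morphism `Z ⟶ X⟦1⟧`. -/
lemma exists_image_connecting {n : ℤ} (hX : t.IsGE X n) (hZ : t.IsLE Z (n - 1)) :
    ∃ I, t.IsLE I (n - 1) ∧ t.IsGE I (n - 1) ∧ IsExtension ((t.truncLT n).obj Y) Z I ∧
      IsExtension X ((t.truncGE n).obj Y) I := by
  obtain ⟨I, hI, hI'⟩ := (isExtension_trunc t Y n).exists_cone_comp h.rotate
  refine ⟨I, hI.isLE_right (t.isLE_of_le _ (n - 1) _) hZ,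
    hI'.isGE_mid (t.isGE_of_ge _ (n - 1) n) (t.isGE_shift X n 1 (n - 1)), hI,
    hI'.invRotate.congr ?_ (.refl _) (.refl _)⟩
  exact (shiftEquiv C (1 : ℤ)).unitIso.symm.app X

end IsExtension

section Classes

lemma classOf_truncLT_of_isLE {X : C} {n : ℤ} (hX : t.IsLE X (n - 1)) :
    classOf ((t.truncLT n).obj X) = classOf X :=
  have ⟨⟨e⟩, _⟩ := (IsExtension.of_isZero_right (isZero_zero C) (Iso.refl X)).nonempty_iso_trunc
    hX (t.isGE_of_isZero (isZero_zero C) n)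
  (classOf_eq_of_iso e).symm

lemma classOf_truncLT_of_isGE {X : C} {n : ℤ} (hX : t.IsGE X n) :
    classOf ((t.truncLT n).obj X) = 0 :=
  classOf_eq_zero ((t.isGE_iff_isZero_truncLT_obj n X).1 hX)

lemma classOf_truncLT_shift (X : C) (n a : ℤ) :
    classOf ((t.truncLT n).obj (X⟦a⟧)) =
      a.negOnePow • classOf ((t.truncLT (n + a)).obj X) := by
  have h := (isExtension_trunc t X (n + a)).shift a
  obtain ⟨⟨e⟩, -⟩ := h.nonempty_iso_trunc (t := t) (n := n)
    (t.isLE_shift _ (n + a - 1) a (n - 1)) (t.isGE_shift _ (n + a) a n)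
  rw [← classOf_eq_of_iso e, classOf_shift]

variable [IsTriangulated C]

lemma IsExtension.classOf_truncLT_of_isLE_left {X Y Z : C} (h : IsExtension X Y Z) {n : ℤ}
    (hX : t.IsLE X (n - 1)) :
    classOf ((t.truncLT n).obj Y) =
      classOf ((t.truncLT n).obj X) + classOf ((t.truncLT n).obj Z) := by
  rw [classOf_truncLT_of_isLE hX, (h.truncLT_of_isLE_left hX).classOf_eq_add]

lemma IsExtension.classOf_truncLT_of_isGE_right {X Y Z : C} (h : IsExtension X Y Z) {n : ℤ}
    (hZ : t.IsGE Z n) :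
    classOf ((t.truncLT n).obj Y) =
      classOf ((t.truncLT n).obj X) + classOf ((t.truncLT n).obj Z) := by
  obtain ⟨e⟩ := h.nonempty_truncLT_iso_of_isGE_right hZ
  rw [classOf_truncLT_of_isGE hZ, add_zero, classOf_eq_of_iso e]

/-- The defect of additivity of truncation is the image of the connecting morphism between the
cohomology objects in degrees `n - 1` and `n`. -/
lemma IsExtension.exists_classOf_truncLT_add {X Y Z : C} (h : IsExtension X Y Z) (n : ℤ) :
    ∃ I, t.IsLE I (n - 1) ∧ t.IsGE I (n - 1) ∧
      classOf ((t.truncLT n).obj X) + classOf ((t.truncLT n).obj Z) =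
        classOf ((t.truncLT n).obj Y) + classOf I := by
  obtain ⟨D, hD, hDZ⟩ := (isExtension_trunc t X n).exists_cone_comp h
  obtain ⟨D', hD', hD''⟩ := hDZ.exists_fiber_comp (isExtension_trunc t Z n)
  obtain ⟨I, hI, hI', hDI, -⟩ := hD''.exists_image_connecting (t := t) (n := n)
    inferInstance inferInstance
  refine ⟨I, hI, hI', ?_⟩
  rw [hDI.classOf_eq_add, (hD.truncLT_of_isLE_left inferInstance).classOf_eq_add,
    hD'.classOf_truncLT_of_isGE_right inferInstance,
    classOf_truncLT_of_isGE (X := (t.truncGE n).obj Z) inferInstance, add_zero, add_assoc]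

end Classes

end Truncations

section Cohomology

variable {t : TStructure C}

lemma heart_shift_of_isLE_of_isGE {X : C} {n : ℤ} (hX : t.IsLE X n) (hX' : t.IsGE X n) :
    t.heart (X⟦n⟧) :=
  (t.mem_heart_iff _).2 ⟨t.isLE_shift X n n 0, t.isGE_shift X n n 0⟩

variable (t) in
/-- The cohomology object `Hⁿ(X) = (τ^{≥ n} τ^{≤ n} X)⟦n⟧` of the t-structure `t`, an object of
its heart. -/
noncomputable def cohomology (n : ℤ) (X : C) : C := ((t.truncGELT n (n + 1)).obj X)⟦n⟧

lemma classOf_cohomology_of_isZero {X : C} (hX : IsZero X) (n : ℤ) :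
    classOf (cohomology t n X) = 0 :=
  classOf_eq_zero ((t.truncGELT n (n + 1) ⋙ shiftFunctor C n).map_isZero hX)

lemma classOf_cohomology_of_iso {X Y : C} (e : X ≅ Y) (n : ℤ) :
    classOf (cohomology t n X) = classOf (cohomology t n Y) :=
  classOf_eq_of_iso ((t.truncGELT n (n + 1) ⋙ shiftFunctor C n).mapIso e)

variable [IsTriangulated C]

lemma heart_cohomology (n : ℤ) (X : C) : t.heart (cohomology t n X) :=
  heart_shift_of_isLE_of_isGE (t.isLE_of_le _ (n + 1 - 1) n) inferInstance

lemma classOf_cohomology (n : ℤ) (X : C) :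
    classOf (cohomology t n X) = n.negOnePow •
      (classOf ((t.truncLT (n + 1)).obj X) - classOf ((t.truncLT n).obj X)) := by
  have h : IsExtension ((t.truncLT n).obj X) ((t.truncLT (n + 1)).obj X)
      ((t.truncGELT n (n + 1)).obj X) :=
    .of_distTriang (t.triangleLTLTGELT_distinguished n (n + 1) (by lia) X)
  rw [cohomology, classOf_shift, eq_sub_of_add_eq' h.classOf_eq_add.symm]

lemma classOf_cohomology_shift (n a : ℤ) (X : C) :
    classOf (cohomology t n (X⟦a⟧)) = classOf (cohomology t (n + a) X) := by
  simp only [classOf_cohomology, classOf_truncLT_shift, ← smul_sub, smul_smul, Int.negOnePow_add,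
    add_right_comm n 1 a]

lemma classOf_cohomology_of_isLE_of_isGE {X : C} {k : ℤ} (hX : t.IsLE X k) (hX' : t.IsGE X k)
    (n : ℤ) : classOf (cohomology t n X) = if n = k then classOf (X⟦k⟧) else 0 := by
  have above (m : ℤ) (hm : k < m) : classOf ((t.truncLT m).obj X) = classOf X :=
    classOf_truncLT_of_isLE (t.isLE_of_le X k _)
  have below (m : ℤ) (hm : m ≤ k) : classOf ((t.truncLT m).obj X) = 0 :=
    classOf_truncLT_of_isGE (t.isGE_of_ge X _ k)
  rw [classOf_cohomology]
  rcases lt_trichotomy n k with hn | rfl | hn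
  · rw [below (n + 1) hn, below n hn.le, if_neg hn.ne, sub_self, smul_zero]
  · rw [above (n + 1) (lt_add_one n), below n le_rfl, if_pos rfl, sub_zero, classOf_shift]
  · rw [above (n + 1) (hn.trans (lt_add_one n)), above n hn, if_neg hn.ne', sub_self, smul_zero]

namespace IsExtension

variable {X Y Z : C} (h : IsExtension X Y Z)
include h

lemma classOf_cohomology_eq_add {k : ℤ} (hX : t.IsLE X k) (hZ : t.IsGE Z k) (n : ℤ) :
    classOf (cohomology t n Y) = classOf (cohomology t n X) + classOf (cohomology t n Z) := by
  have add (m : ℤ) : classOf ((t.truncLT m).obj Y) =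
      classOf ((t.truncLT m).obj X) + classOf ((t.truncLT m).obj Z) := by
    rcases le_or_gt m k with hm | hm
    · exact h.classOf_truncLT_of_isGE_right (t.isGE_of_ge Z m k)
    · exact h.classOf_truncLT_of_isLE_left (t.isLE_of_le X k _)
  rw [classOf_cohomology, classOf_cohomology, classOf_cohomology, add, add, ← smul_add]
  abel_nf

/-- The objects `I` and `J` are the images of the connecting morphisms `Hⁿ⁻¹(Z) ⟶ Hⁿ(X)` and
`Hⁿ(Z) ⟶ Hⁿ⁺¹(X)`. -/
lemma exists_classOf_cohomology_add (n : ℤ) :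
    ∃ I J, t.heart I ∧ t.heart J ∧
      classOf (cohomology t n X) + classOf (cohomology t n Z) =
        classOf (cohomology t n Y) + (classOf I + classOf J) := by
  obtain ⟨I, hI, hI', eqI⟩ := h.exists_classOf_truncLT_add (t := t) n
  obtain ⟨J, hJ, hJ', eqJ⟩ := h.exists_classOf_truncLT_add (t := t) (n + 1)
  rw [add_sub_cancel_right] at hJ hJ'
  refine ⟨_, _, heart_shift_of_isLE_of_isGE hI hI',
    heart_shift_of_isLE_of_isGE hJ hJ', ?_⟩
  have sign : (n - 1).negOnePow = -n.negOnePow := by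
    rw [Int.negOnePow_sub, Int.negOnePow_one, mul_neg, mul_one]
  simp only [classOf_cohomology, classOf_shift, sign, Units.neg_smul, ← smul_neg, ← smul_add]
  congr 1
  rw [← sub_eq_zero] at eqI eqJ ⊢
  rw [← sub_eq_zero.2 (eqJ.trans eqI.symm)]
  abel

variable {A : Type*} [AddCommGroup A] [PartialOrder A] [IsOrderedAddMonoid A]

lemma map_classOf_cohomology_le {W : GrothendieckGroup C →+ A}
    (hW : ∀ X, t.heart X → 0 ≤ W (classOf X)) (n : ℤ) :
    W (classOf (cohomology t n Y)) ≤
      W (classOf (cohomology t n X)) + W (classOf (cohomology t n Z)) := by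
  obtain ⟨I, J, hI, hJ, eq⟩ := h.exists_classOf_cohomology_add (t := t) n
  rw [← map_add, eq, map_add, map_add]
  exact le_add_of_nonneg_right (add_nonneg (hW I hI) (hW J hJ))

end IsExtension

end Cohomology

section Slicings

namespace Slicing

/-- The subcategory `P(I)` of a slicing, as the extension closure of the `P(φ)` with `φ ∈ I`. Unlike
for `phaseInterval`, its stability under extensions is built in, for an arbitrary set `I`. -/
def interval (S : Slicing C) (I : Set ℝ) : ObjectProperty C :=
  ExtensionClosure fun E ↦ ∃ φ ∈ I, S.P φ E

instance (S : Slicing C) (I : Set ℝ) : (S.interval I).ContainsZero :=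
  inferInstanceAs (ExtensionClosure _).ContainsZero

instance (S : Slicing C) (I : Set ℝ) : (S.interval I).IsClosedUnderIsomorphisms :=
  inferInstanceAs (ExtensionClosure _).IsClosedUnderIsomorphisms

instance (S : Slicing C) (I : Set ℝ) : (S.interval I).IsTriangulatedClosed₂ :=
  inferInstanceAs (ExtensionClosure _).IsTriangulatedClosed₂

variable {S : Slicing C} {I J : Set ℝ}

lemma interval_of_P {φ : ℝ} (hφ : φ ∈ I) {E : C} (hE : S.P φ E) : S.interval I E :=
  .of_mem ⟨φ, hφ, hE⟩

lemma interval_mono (h : I ⊆ J) : S.interval I ≤ S.interval J :=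
  ExtensionClosure.mono fun _ ⟨φ, hφ, hE⟩ ↦ ⟨φ, h hφ, hE⟩

lemma interval_hom_eq_zero (h : ∀ x ∈ I, ∀ y ∈ J, y < x) {E F : C} (hE : S.interval I E)
    (hF : S.interval J F) (f : E ⟶ F) : f = 0 :=
  ExtensionClosure.hom_eq_zero
    (fun _ ⟨φ, hφ, hX⟩ _ f ⟨ψ, hψ, hY⟩ ↦ S.hom_eq_zero φ ψ (h φ hφ ψ hψ) _ _ f hX hY) hE hF f

lemma P_shift {φ : ℝ} {E : C} (hE : S.P φ E) (n : ℤ) : S.P (φ + n) (E⟦n⟧) := by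
  have := S.isClosedUnderIsomorphisms
  have succ_iff (m : ℤ) : S.P (φ + (m + 1 : ℤ)) (E⟦m + 1⟧) ↔ S.P (φ + m) (E⟦m⟧) := by
    rw [← S.shift_iff (φ + m), Int.cast_add, Int.cast_one, ← add_assoc]
    exact (S.P _).prop_iff_of_iso ((shiftFunctorAdd' C m 1 (m + 1) rfl).app E)
  induction n using Int.induction_on with
  | zero =>
    rw [Int.cast_zero, add_zero]
    exact (S.P φ).prop_of_iso ((shiftFunctorZero C ℤ).app E).symm hE
  | succ n ih => exact (succ_iff n).2 ih
  | pred n ih => exact (succ_iff (-n - 1)).1 (by rwa [sub_add_cancel])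

lemma interval_shift (n : ℤ) (h : ∀ x ∈ I, x + n ∈ J) {E : C} (hE : S.interval I E) :
    S.interval J (E⟦n⟧) :=
  ExtensionClosure.shift n (fun _ ⟨φ, hφ, hX⟩ ↦ ⟨φ + n, h φ hφ, P_shift hX n⟩) hE

end Slicing

namespace HNFiltration

section Family

variable {P : ℝ → ObjectProperty C} {E : C} (F : HNFiltration P E)

lemma isExtension (i : Fin F.length) :
    IsExtension (F.obj i.castSucc) (F.obj i.succ) (F.factor i) :=
  .of_distTriang (F.distinguished i)

section Closed

variable {Q : ObjectProperty C} [Q.ContainsZero] [Q.IsClosedUnderIsomorphisms]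
  [Q.IsTriangulatedClosed₂]

lemma prop_obj (i : Fin (F.length + 1)) (h : ∀ j : Fin F.length, j.castSucc < i → Q (F.factor j)) :
    Q (F.obj i) := by
  induction i using Fin.induction with
  | zero => exact Q.prop_of_isZero F.isZero_bot
  | succ i ih =>
    exact Q.ext_of_isTriangulatedClosed₂ _ (F.distinguished i)
      (ih fun j hj ↦ h j (hj.trans Fin.castSucc_lt_succ)) (h i Fin.castSucc_lt_succ)

lemma prop (h : ∀ i, Q (F.factor i)) : Q E :=
  Q.prop_of_iso F.topIso (F.prop_obj _ fun j _ ↦ h j)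

end Closed

lemma map_eq_sum {A : Type*} [AddCommMonoid A] (f : C → A) (zero : ∀ X, IsZero X → f X = 0)
    (iso : ∀ X Y, (X ≅ Y) → f X = f Y)
    (add : ∀ i, f (F.obj i.succ) = f (F.obj i.castSucc) + f (F.factor i)) :
    f E = ∑ i, f (F.factor i) := by
  have partialSum (i) : f (F.obj i) = Fin.partialSum (fun i ↦ f (F.factor i)) i := by
    induction i using Fin.induction with
    | zero => rw [zero _ F.isZero_bot, Fin.partialSum_zero]
    | succ i ih => rw [add, ih, Fin.partialSum_succ]
  rw [← iso _ _ F.topIso, partialSum, Fin.partialSum, ← Fin.sum_ofFn]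
  congr 1
  exact List.take_of_length_le (by simp)

lemma classOf_eq_sum_factor : classOf E = ∑ i, classOf (F.factor i) :=
  F.map_eq_sum classOf (fun _ ↦ classOf_eq_zero) (fun _ _ ↦ classOf_eq_of_iso)
    fun i ↦ (F.isExtension i).classOf_eq_add

end Family

variable {S : Slicing C} {E : C} (F : HNFiltration S.P E)

lemma interval_obj_castSucc (i : Fin F.length) :
    S.interval (Set.Ioi (F.phase i)) (F.obj i.castSucc) :=
  F.prop_obj _ fun j hj ↦
    Slicing.interval_of_P (F.strictAnti (Fin.castSucc_lt_castSucc_iff.1 hj)) (F.mem j)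

lemma interval_of_phase_mem {I : Set ℝ} (h : ∀ i, F.phase i ∈ I) : S.interval I E :=
  F.prop fun i ↦ Slicing.interval_of_P (h i) (F.mem i)

lemma proj_ne_zero (i : Fin F.length) : F.proj i ≠ 0 := by
  intro h
  obtain ⟨r, hr⟩ := Triangle.yoneda_exact₃ _ (F.distinguished i) (𝟙 (F.factor i))
    (show F.proj i ≫ 𝟙 _ = 0 by rw [h, zero_comp])
  have hshift : S.interval (Set.Ioi (F.phase i)) ((F.obj i.castSucc)⟦(1 : ℤ)⟧) :=
    Slicing.interval_shift 1 (fun x (hx : F.phase i < x) ↦ show F.phase i < _ by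
      push_cast; linarith) (F.interval_obj_castSucc i)
  have hr' : r = 0 := Slicing.interval_hom_eq_zero (J := {F.phase i})
    (fun x hx _ hy ↦ hy.trans_lt hx) hshift
    (Slicing.interval_of_P (Set.mem_singleton _) (F.mem i)) r
  exact F.nonzero i ((IsZero.iff_id_eq_zero _).2 (by rw [hr, hr']; exact comp_zero))

lemma exists_hom_factor_ne_zero (h : F.length ≠ 0) :
    ∃ l, (∀ i, F.phase l ≤ F.phase i) ∧ ∃ g : E ⟶ F.factor l, g ≠ 0 := by
  obtain ⟨l, hl⟩ := Fin.exists_succ_eq.2 (show Fin.last F.length ≠ 0 by simpa using h)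
  refine ⟨l, fun i ↦ F.strictAnti.antitone ?_, F.topIso.inv ≫ (eqToHom (by rw [hl])) ≫ F.proj l,
    fun hg ↦ F.proj_ne_zero l ?_⟩
  · rw [← Fin.succ_le_succ_iff, hl]
    exact Fin.le_last _
  · rwa [← cancel_epi (F.topIso.inv ≫ eqToHom (congrArg F.obj hl.symm)), comp_zero,
      Category.assoc]

lemma exists_hom_obj_ne_zero {l : Fin F.length} (hl : (l : ℕ) = 0) (i : Fin (F.length + 1))
    (hi : i ≠ 0) : ∃ g : F.factor l ⟶ F.obj i, g ≠ 0 := by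
  induction i using Fin.induction with
  | zero => exact absurd rfl hi
  | succ i ih =>
    by_cases h0 : i = l
    · subst h0
      have hz : IsZero (F.obj i.castSucc) := by
        rw [show i.castSucc = 0 from Fin.ext hl]
        exact F.isZero_bot
      have : IsIso (F.proj i) := (Triangle.isZero₁_iff_isIso₂ _ (F.distinguished i)).1 hz
      refine ⟨inv (F.proj i), fun h ↦ F.nonzero i ((IsZero.iff_id_eq_zero _).2 ?_)⟩
      rw [← IsIso.inv_hom_id (F.proj i), h, zero_comp]
    · have hli : l < i := lt_of_le_of_ne (Fin.le_def.2 (hl ▸ Nat.zero_le _)) (Ne.symm h0)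
      obtain ⟨g, hg⟩ := ih fun h ↦ by
        simp only [Fin.ext_iff, Fin.val_castSucc, Fin.val_zero] at h
        lia
      refine ⟨g ≫ F.incl i, fun h ↦ hg ?_⟩
      obtain ⟨r, hr⟩ := Triangle.coyoneda_exact₂ _ (inv_rot_of_distTriang _ (F.distinguished i)) g h
      have hr' : r = 0 := S.hom_eq_zero (F.phase l) (F.phase i + ((-1 : ℤ) : ℝ))
        (by push_cast; linarith [F.strictAnti hli]) _ _ r (F.mem l) (Slicing.P_shift (F.mem i) (-1))
      rw [hr, hr']
      exact zero_comp

lemma exists_factor_hom_ne_zero (h : F.length ≠ 0) :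
    ∃ l, (∀ i, F.phase i ≤ F.phase l) ∧ ∃ g : F.factor l ⟶ E, g ≠ 0 := by
  let l : Fin F.length := ⟨0, Nat.pos_of_ne_zero h⟩
  obtain ⟨g, hg⟩ := F.exists_hom_obj_ne_zero (l := l) rfl (Fin.last _) (by simpa using h)
  exact ⟨l, fun i ↦ F.strictAnti.antitone (Fin.le_def.2 (Nat.zero_le _)), g ≫ F.topIso.hom,
    fun h ↦ hg (by rwa [← cancel_mono F.topIso.hom, zero_comp])⟩

lemma phase_mem_of_isUpperSet {I : Set ℝ} (hI : IsUpperSet I) (hE : S.interval I E)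
    (i : Fin F.length) : F.phase i ∈ I := by
  obtain ⟨l, hl, g, hg⟩ := F.exists_hom_factor_ne_zero (Fin.pos i).ne'
  by_contra hi
  exact hg (Slicing.interval_hom_eq_zero (J := {F.phase l})
    (fun x hx y hy ↦ lt_of_not_ge fun h ↦ hi (hI (h.trans (hy.trans_le (hl i))) hx)) hE
    (Slicing.interval_of_P (Set.mem_singleton _) (F.mem l)) g)

lemma phase_mem_of_isLowerSet {I : Set ℝ} (hI : IsLowerSet I) (hE : S.interval I E)
    (i : Fin F.length) : F.phase i ∈ I := by
  obtain ⟨l, hl, g, hg⟩ := F.exists_factor_hom_ne_zero (Fin.pos i).ne'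
  by_contra hi
  exact hg (Slicing.interval_hom_eq_zero (I := {F.phase l})
    (fun x hx y hy ↦ lt_of_not_ge fun h ↦ hi (hI ((hl i).trans (hx.symm.trans_le h)) hy))
    (Slicing.interval_of_P (Set.mem_singleton _) (F.mem l)) hE g)

lemma length_eq_zero (hE : IsZero E) : F.length = 0 := by
  by_contra h
  exact F.phase_mem_of_isUpperSet isUpperSet_empty ((S.interval ∅).prop_of_isZero hE)
    ⟨0, Nat.pos_of_ne_zero h⟩

end HNFiltration

namespace Slicing

variable (S : Slicing C)

lemma phase_le_phiPlus (E : C) (i) : (S.hn E).phase i ≤ S.phiPlus E :=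
  le_ciSup (Set.finite_range _).bddAbove i

lemma phiMinus_le_phase (E : C) (i) : S.phiMinus E ≤ (S.hn E).phase i :=
  ciInf_le (Set.finite_range _).bddBelow i

lemma interval_Icc_phiMinus_phiPlus (E : C) :
    S.interval (Set.Icc (S.phiMinus E) (S.phiPlus E)) E :=
  (S.hn E).interval_of_phase_mem fun i ↦ ⟨S.phiMinus_le_phase E i, S.phase_le_phiPlus E i⟩

variable [IsTriangulated C]

lemma exists_isExtension (a : ℝ) (E : C) :
    ∃ X Y, S.interval (Set.Ioi a) X ∧ S.interval (Set.Iic a) Y ∧ IsExtension X E Y := by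
  have exists_obj (i) : ∃ X Y, S.interval (Set.Ioi a) X ∧ S.interval (Set.Iic a) Y ∧
      IsExtension X ((S.hn E).obj i) Y := by
    induction i using Fin.induction with
    | zero =>
      have hz := (S.hn E).isZero_bot
      exact ⟨_, _, .of_isZero hz, .of_isZero hz, .of_isZero_left hz (Iso.refl _)⟩
    | succ i ih =>
      have hT := (S.hn E).isExtension i
      rcases le_or_gt ((S.hn E).phase i) a with ha | ha
      · obtain ⟨X, Y, hX, hY, h⟩ := ih
        obtain ⟨D, h₁, h₂⟩ := h.exists_cone_comp hT
        exact ⟨X, D, hX, .extension h₂ hY (interval_of_P (Set.mem_Iic.2 ha) ((S.hn E).mem i)), h₁⟩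
      · exact ⟨_, 0, .extension hT
          (interval_mono (Set.Ioi_subset_Ioi ha.le) _ ((S.hn E).interval_obj_castSucc i))
          (interval_of_P ha ((S.hn E).mem i)), .of_isZero (isZero_zero C),
          .of_isZero_right (isZero_zero C) (Iso.refl _)⟩
  obtain ⟨X, Y, hX, hY, h⟩ := exists_obj (Fin.last _)
  exact ⟨X, Y, hX, hY, h.congr (Iso.refl _) (S.hn E).topIso (Iso.refl _)⟩

/-- The t-structure with heart `P((a, a + 1])` attached to a slicing. -/
def tStructure (a : ℝ) : TStructure C where
  le n := S.interval (Set.Ioi (a - n))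
  ge n := S.interval (Set.Iic (a + 1 - n))
  le_isClosedUnderIsomorphisms _ := inferInstance
  ge_isClosedUnderIsomorphisms _ := inferInstance
  le_shift n k n' h X hX := interval_shift k (fun x hx ↦ by
    subst h
    simp only [Set.mem_Ioi, Int.cast_add] at hx ⊢
    linarith) hX
  ge_shift n k n' h X hX := interval_shift k (fun x hx ↦ by
    subst h
    simp only [Set.mem_Iic, Int.cast_add] at hx ⊢
    linarith) hX
  zero' X Y f hX hY := interval_hom_eq_zero (fun x hx y hy ↦ by
    simp only [Set.mem_Iic, Set.mem_Ioi, Int.cast_zero, Int.cast_one] at hx hy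
    linarith) hX hY f
  le_zero_le := interval_mono (Set.Ioi_subset_Ioi (by simp))
  ge_one_le := interval_mono (Set.Iic_subset_Iic.2 (by simp))
  exists_triangle_zero_one E := by
    obtain ⟨X, Y, hX, hY, f, g, h, hT⟩ := S.exists_isExtension a E
    exact ⟨X, Y, by simpa using hX, by simpa using hY, f, g, h, hT⟩

lemma isBoundedTStructure (a : ℝ) : IsBoundedTStructure (S.tStructure a) := by
  intro E
  have h := S.interval_Icc_phiMinus_phiPlus E
  refine ⟨⟨-⌈S.phiPlus E - (a + 1)⌉, ⟨interval_mono (fun x hx ↦ ?_) _ h⟩⟩,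
    ⟨⌊a - S.phiMinus E⌋ + 1, ⟨interval_mono (fun x hx ↦ ?_) _ h⟩⟩⟩
  · have := Int.le_ceil (S.phiPlus E - (a + 1))
    simp only [Set.mem_Iic, Int.cast_neg]
    linarith [hx.2]
  · have := Int.lt_floor_add_one (a - S.phiMinus E)
    simp only [Set.mem_Ioi, Int.cast_add, Int.cast_one]
    linarith [hx.1]

variable {S} in
lemma heart_tStructure_iff {a : ℝ} {E : C} : (S.tStructure a).heart E ↔
    S.interval (Set.Ioi a) E ∧ S.interval (Set.Iic (a + 1)) E := by
  change S.interval (Set.Ioi (a - (0 : ℤ))) E ∧ S.interval (Set.Iic (a + 1 - (0 : ℤ))) E ↔ _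
  rw [Int.cast_zero, sub_zero, sub_zero]

lemma heart_tStructure (a : ℝ) :
    (S.tStructure a).heart = phaseInterval S.P (Set.Ioc a (a + 1)) := by
  ext E
  rw [heart_tStructure_iff]
  exact ⟨fun ⟨h₁, h₂⟩ ↦ ⟨S.hn E, fun i ↦
    ⟨(S.hn E).phase_mem_of_isUpperSet (isUpperSet_Ioi a) h₁ i,
      (S.hn E).phase_mem_of_isLowerSet (isLowerSet_Iic _) h₂ i⟩⟩,
    fun ⟨F, hF⟩ ↦ ⟨F.interval_of_phase_mem fun i ↦ (hF i).1,
      F.interval_of_phase_mem fun i ↦ (hF i).2⟩⟩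

end Slicing

end Slicings

lemma abs_map_classOf_shift (W : GrothendieckGroup C →+ ℝ) (X : C) (n : ℤ) :
    |W (classOf (X⟦n⟧))| = |W (classOf X)| := by
  rcases Int.even_or_odd n with hn | hn
  · rw [classOf_shift, Int.negOnePow_even n hn, one_smul]
  · rw [classOf_shift, Int.negOnePow_odd n hn, Units.neg_smul, one_smul, map_neg, abs_neg]

namespace HNFiltration

variable [IsTriangulated C] {S : Slicing C} {E : C} (F : HNFiltration S.P E)

lemma exists_isLE_isGE_factor (a : ℝ) (i : Fin F.length) :
    ∃ k : ℤ, (S.tStructure a).IsLE (F.factor i) k ∧ (S.tStructure a).IsGE (F.factor i) k ∧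
      (S.tStructure a).IsLE (F.obj i.castSucc) k := by
  have h₁ := Int.le_ceil (F.phase i - (a + 1))
  have h₂ := Int.ceil_lt_add_one (F.phase i - (a + 1))
  refine ⟨-⌈F.phase i - (a + 1)⌉, ⟨Slicing.interval_of_P ?_ (F.mem i)⟩,
    ⟨Slicing.interval_of_P ?_ (F.mem i)⟩,
    ⟨Slicing.interval_mono (Set.Ioi_subset_Ioi ?_) _ (F.interval_obj_castSucc i)⟩⟩
  · simp only [Set.mem_Ioi, Int.cast_neg]; linarith
  · simp only [Set.mem_Iic, Int.cast_neg]; linarith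
  · simp only [Int.cast_neg]; linarith

lemma classOf_cohomology_eq_sum (a : ℝ) (n : ℤ) :
    classOf (cohomology (S.tStructure a) n E) =
      ∑ i, classOf (cohomology (S.tStructure a) n (F.factor i)) :=
  F.map_eq_sum (fun X ↦ classOf (cohomology _ n X)) (fun _ h ↦ classOf_cohomology_of_isZero h n)
    (fun _ _ e ↦ classOf_cohomology_of_iso e n) fun i ↦
      let ⟨_, _, h₂, h₃⟩ := F.exists_isLE_isGE_factor a i
      (F.isExtension i).classOf_cohomology_eq_add h₃ h₂ n

end HNFiltration

lemma abs_sin_sub_le (x y : ℝ) : |Real.sin (x - y)| ≤ |Real.sin x| + |Real.sin y| :=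
  calc |Real.sin (x - y)|
    _ ≤ |Real.sin x * Real.cos y| + |Real.cos x * Real.sin y| := by
        rw [Real.sin_sub]
        exact abs_sub _ _
    _ ≤ |Real.sin x| + |Real.sin y| := by
        rw [abs_mul, abs_mul]
        exact add_le_add (mul_le_of_le_one_right (abs_nonneg _) (Real.abs_cos_le_one _))
          (mul_le_of_le_one_left (abs_nonneg _) (Real.abs_cos_le_one _))

lemma sin_le_sin_of_mem_Icc {x y : ℝ} (hx : 0 ≤ x) (hy : y ∈ Set.Icc x (Real.pi - x)) :
    Real.sin x ≤ Real.sin y := by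
  rcases le_total y (Real.pi / 2) with h | h
  · exact Real.sin_le_sin_of_le_of_le_pi_div_two (by linarith [Real.pi_pos]) h hy.1
  · rw [← Real.sin_pi_sub y]
    exact Real.sin_le_sin_of_le_of_le_pi_div_two (by linarith [Real.pi_pos]) (by linarith)
      (by linarith [hy.2])

namespace StabilityCondition

variable {Λ : Type w} [AddCommGroup Λ] {p : GrothendieckGroup C →+ Λ} (σ : StabilityCondition p)

/-- The imaginary part `Im (exp (-iπa) Z)` of the central charge rotated by the phase `a`. It is
additive on `K(C)`, and nonnegative on the heart `P((a, a + 1])`. -/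
noncomputable def rotatedIm (a : ℝ) : GrothendieckGroup C →+ ℝ :=
  (Complex.imAddGroupHom.comp
    (AddMonoidHom.mulLeft (Complex.exp (-(a * Real.pi : ℝ) * Complex.I)))).comp (σ.Z.comp p)

/-- The analogue of the mass for the function `rotatedIm`: the sum of its absolute values over the
Harder-Narasimhan factors of `E`. -/
noncomputable def imMass (a : ℝ) (E : C) : ℝ :=
  ∑ i, |σ.rotatedIm a (classOf ((σ.slicing.hn E).factor i))|

lemma rotatedIm_apply (a : ℝ) (x : GrothendieckGroup C) :
    σ.rotatedIm a x = (Complex.exp (-(a * Real.pi : ℝ) * Complex.I) * σ.Z (p x)).im := rfl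

lemma rotatedIm_classOf_of_P {φ : ℝ} {E : C} (h : σ.slicing.P φ E) (a : ℝ) :
    σ.rotatedIm a (classOf E) = ‖σ.Z (p (classOf E))‖ * Real.sin (Real.pi * (φ - a)) := by
  by_cases hE : IsZero E
  · simp [classOf_eq_zero hE]
  obtain ⟨r, hr, hZ⟩ := σ.compatible φ E h hE
  have rotated : Complex.exp (-(a * Real.pi : ℝ) * Complex.I) * σ.Z (p (classOf E)) =
      r * Complex.exp ((Real.pi * (φ - a) : ℝ) * Complex.I) := by
    rw [hZ, mul_left_comm, ← Complex.exp_add]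
    congr 2
    push_cast
    ring
  have norm_eq : ‖σ.Z (p (classOf E))‖ = r := by
    rw [hZ, mul_comm Complex.I, mul_right_comm, ← Complex.ofReal_mul, norm_mul,
      Complex.norm_exp_ofReal_mul_I, mul_one, Complex.norm_real, Real.norm_of_nonneg hr.le]
  rw [rotatedIm_apply, rotated, norm_eq, Complex.im_ofReal_mul, Complex.exp_ofReal_mul_I_im]

lemma abs_rotatedIm_le (a : ℝ) (x : GrothendieckGroup C) : |σ.rotatedIm a x| ≤ ‖σ.Z (p x)‖ := by
  refine (Complex.abs_im_le_norm _).trans ?_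
  rw [AddMonoidHom.coe_mulLeft, norm_mul, ← Complex.ofReal_neg, Complex.norm_exp_ofReal_mul_I,
    one_mul, AddMonoidHom.comp_apply]

lemma imMass_le_mass (a : ℝ) (E : C) : σ.imMass a E ≤ σ.mass E :=
  Finset.sum_le_sum fun _ _ ↦ σ.abs_rotatedIm_le a _

lemma mass_nonneg (E : C) : 0 ≤ σ.mass E := Finset.sum_nonneg fun _ _ ↦ norm_nonneg _

lemma mass_eq_zero_of_isZero {E : C} (hE : IsZero E) : σ.mass E = 0 := by
  have : IsEmpty (Fin (σ.slicing.hn E).length) := by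
    rw [(σ.slicing.hn E).length_eq_zero hE]
    infer_instance
  exact Finset.sum_of_isEmpty _

lemma rotatedIm_classOf_eq_sum (a : ℝ) (E : C) :
    σ.rotatedIm a (classOf E) = ∑ i, ‖σ.Z (p (classOf ((σ.slicing.hn E).factor i)))‖ *
      Real.sin (Real.pi * ((σ.slicing.hn E).phase i - a)) := by
  rw [(σ.slicing.hn E).classOf_eq_sum_factor, map_sum]
  exact Finset.sum_congr rfl fun i _ ↦ σ.rotatedIm_classOf_of_P ((σ.slicing.hn E).mem i) a

lemma rotatedIm_classOf_le_mass (a : ℝ) (E : C) : σ.rotatedIm a (classOf E) ≤ σ.mass E := by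
  rw [rotatedIm_classOf_eq_sum]
  exact Finset.sum_le_sum fun i _ ↦ mul_le_of_le_one_right (norm_nonneg _) (Real.sin_le_one _)

lemma sin_mul_mass_le_rotatedIm_classOf {a d : ℝ} (hd : 0 ≤ d) {E : C}
    (hE : σ.slicing.interval (Set.Icc (a + d) (a + 1 - d)) E) :
    Real.sin (Real.pi * d) * σ.mass E ≤ σ.rotatedIm a (classOf E) := by
  rw [rotatedIm_classOf_eq_sum, mul_comm, mass, Finset.sum_mul]
  refine Finset.sum_le_sum fun i _ ↦ mul_le_mul_of_nonneg_left ?_ (norm_nonneg _)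
  have lower : a + d ≤ _ := (σ.slicing.hn E).phase_mem_of_isUpperSet (isUpperSet_Ici _)
    (Slicing.interval_mono Set.Icc_subset_Ici_self _ hE) i
  have upper : _ ≤ a + 1 - d := (σ.slicing.hn E).phase_mem_of_isLowerSet (isLowerSet_Iic _)
    (Slicing.interval_mono Set.Icc_subset_Iic_self _ hE) i
  exact sin_le_sin_of_mem_Icc (by positivity)
    ⟨by nlinarith [Real.pi_pos], by nlinarith [Real.pi_pos]⟩

lemma abs_sin_mul_mass_le (a b : ℝ) (E : C) :
    |Real.sin (Real.pi * (a - b))| * σ.mass E ≤ σ.imMass a E + σ.imMass b E := by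
  rw [mass, imMass, imMass, Finset.mul_sum, ← Finset.sum_add_distrib]
  refine Finset.sum_le_sum fun i _ ↦ ?_
  let φ := (σ.slicing.hn E).phase i
  rw [σ.rotatedIm_classOf_of_P ((σ.slicing.hn E).mem i),
    σ.rotatedIm_classOf_of_P ((σ.slicing.hn E).mem i), abs_mul, abs_mul, abs_norm, ← mul_add,
    mul_comm, show Real.pi * (a - b) = Real.pi * (φ - b) - Real.pi * (φ - a) by ring]
  exact mul_le_mul_of_nonneg_left ((abs_sin_sub_le _ _).trans_eq (add_comm _ _)) (norm_nonneg _)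

lemma mass_le_imMass_add_imMass (E : C) : σ.mass E ≤ σ.imMass 0 E + σ.imMass (1 / 2) E := by
  have := σ.abs_sin_mul_mass_le (1 / 2) 0 E
  rw [sub_zero, mul_one_div, Real.sin_pi_div_two, abs_one, one_mul] at this
  linarith

variable [IsTriangulated C]

lemma rotatedIm_classOf_nonneg {a : ℝ} (E : C) (hE : (σ.slicing.tStructure a).heart E) :
    0 ≤ σ.rotatedIm a (classOf E) := by
  rw [Slicing.heart_tStructure] at hE
  obtain ⟨F, hF⟩ := hE
  rw [F.classOf_eq_sum_factor, map_sum]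
  refine Finset.sum_nonneg fun i _ ↦ ?_
  rw [σ.rotatedIm_classOf_of_P (F.mem i)]
  refine mul_nonneg (norm_nonneg _) (Real.sin_nonneg_of_nonneg_of_le_pi ?_ ?_)
  · exact mul_nonneg Real.pi_pos.le (by linarith [(hF i).1])
  · exact mul_le_of_le_one_right Real.pi_pos.le (by linarith [(hF i).2])

lemma hasSum_rotatedIm_classOf_cohomology (a : ℝ) (E : C) :
    HasSum (fun n ↦ σ.rotatedIm a (classOf (cohomology (σ.slicing.tStructure a) n E)))
      (σ.imMass a E) := by
  simp only [(σ.slicing.hn E).classOf_cohomology_eq_sum, map_sum]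
  refine hasSum_sum fun i _ ↦ ?_
  obtain ⟨k, h₁, h₂, -⟩ := (σ.slicing.hn E).exists_isLE_isGE_factor a i
  rw [← abs_map_classOf_shift _ _ k,
    abs_of_nonneg (σ.rotatedIm_classOf_nonneg _ (heart_shift_of_isLE_of_isGE h₁ h₂))]
  simp only [classOf_cohomology_of_isLE_of_isGE h₁ h₂, apply_ite (σ.rotatedIm a), map_zero]
  exact hasSum_ite_eq k _

lemma imMass_le_add (a : ℝ) {E F G : C} (h : IsExtension E F G) :
    σ.imMass a F ≤ σ.imMass a E + σ.imMass a G :=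
  hasSum_le (h.map_classOf_cohomology_le σ.rotatedIm_classOf_nonneg)
    (σ.hasSum_rotatedIm_classOf_cohomology a F)
    ((σ.hasSum_rotatedIm_classOf_cohomology a E).add (σ.hasSum_rotatedIm_classOf_cohomology a G))

lemma imMass_shift (a : ℝ) (E : C) (n : ℤ) : σ.imMass a (E⟦n⟧) = σ.imMass a E := by
  have h := σ.hasSum_rotatedIm_classOf_cohomology a (E⟦n⟧)
  simp only [classOf_cohomology_shift] at h
  have h' := (Equiv.addRight n).hasSum_iff.2 (σ.hasSum_rotatedIm_classOf_cohomology a E)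
  exact h.unique h'

lemma imMass_left_le {a : ℝ} {E F G : C} (h : IsExtension E F G)
    (hE : σ.slicing.interval (Set.Ioi a) E) (hG : σ.slicing.interval (Set.Iic a) G) :
    σ.imMass a E ≤ σ.imMass a F := by
  refine hasSum_le (fun n ↦ ?_) (σ.hasSum_rotatedIm_classOf_cohomology a E)
    (σ.hasSum_rotatedIm_classOf_cohomology a F)
  rw [h.classOf_cohomology_eq_add (k := 0)
    ⟨Slicing.interval_mono (Set.Ioi_subset_Ioi (by simp)) _ hE⟩
    ⟨Slicing.interval_mono (Set.Iic_subset_Iic.2 (by simp)) _ hG⟩, map_add]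
  exact le_add_of_nonneg_right (σ.rotatedIm_classOf_nonneg _ (heart_cohomology n G))

lemma mass_le_two_mul_add {E F G : C} (h : IsExtension E F G) :
    σ.mass F ≤ 2 * (σ.mass E + σ.mass G) := by
  linarith [σ.mass_le_imMass_add_imMass F, σ.imMass_le_add 0 h, σ.imMass_le_add (1 / 2) h,
    σ.imMass_le_mass 0 E, σ.imMass_le_mass 0 G, σ.imMass_le_mass (1 / 2) E,
    σ.imMass_le_mass (1 / 2) G]

lemma mass_shift_le (E : C) (n : ℤ) : σ.mass (E⟦n⟧) ≤ 2 * σ.mass E := by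
  have := σ.mass_le_imMass_add_imMass (E⟦n⟧)
  rw [imMass_shift, imMass_shift] at this
  linarith [σ.imMass_le_mass 0 E, σ.imMass_le_mass (1 / 2) E]

lemma mass_left_le {a b : ℝ} (hab : a ≤ b) {E F G : C} (h : IsExtension E F G)
    (hE : σ.slicing.interval (Set.Ioi b) E) (hG : σ.slicing.interval (Set.Iic a) G) :
    |Real.sin (Real.pi * (b - a))| * σ.mass E ≤ 2 * σ.mass F := by
  linarith [σ.abs_sin_mul_mass_le b a E,
    σ.imMass_left_le h hE (Slicing.interval_mono (Set.Iic_subset_Iic.2 hab) _ hG),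
    σ.imMass_left_le h (Slicing.interval_mono (Set.Ioi_subset_Ioi hab) _ hE) hG,
    σ.imMass_le_mass a F, σ.imMass_le_mass b F]

end StabilityCondition

section Massless

variable {Λ : Type w} [AddCommGroup Λ] {p : GrothendieckGroup C →+ Λ}

/-- The objects which, for every small `δ > 0`, lie in `P_n(I δ)` for all large `n`. The parameter
`δ` absorbs the error made in comparing the slicings `P_n` with their limit. -/
def eventualInterval (σ : ℕ → StabilityCondition p) (I : ℝ → Set ℝ) : ObjectProperty C :=
  fun E ↦ ∀ᶠ δ in 𝓝[>] 0, ∀ᶠ n in atTop, (σ n).slicing.interval (I δ) E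

variable {σ : ℕ → StabilityCondition p}

section EventualInterval

variable {I J : ℝ → Set ℝ}

instance : (eventualInterval σ I).ContainsZero :=
  ⟨⟨0, isZero_zero C, .of_forall fun _ ↦ .of_forall fun _ ↦ .of_isZero (isZero_zero C)⟩⟩

instance : (eventualInterval σ I).IsClosedUnderIsomorphisms :=
  ⟨fun e h ↦ h.mono fun _ h ↦ h.mono fun _ h ↦ ObjectProperty.prop_of_iso _ e h⟩

instance : (eventualInterval σ I).IsTriangulatedClosed₂ :=
  .mk' fun T hT h₁ h₃ ↦ by
    filter_upwards [h₁, h₃] with δ h₁ h₃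
    filter_upwards [h₁, h₃] with n h₁ h₃
    exact ObjectProperty.ext_of_isTriangulatedClosed₂ _ T hT h₁ h₃

lemma eventualInterval_mono (h : ∀ δ, I δ ⊆ J δ) : eventualInterval σ I ≤ eventualInterval σ J :=
  fun _ hE ↦ hE.mono fun δ hδ ↦ hδ.mono fun _ hn ↦ Slicing.interval_mono (h δ) _ hn

lemma eventualInterval_shift (n : ℤ) (h : ∀ δ, ∀ x ∈ I δ, x + n ∈ J δ) {E : C}
    (hE : eventualInterval σ I E) : eventualInterval σ J (E⟦n⟧) :=
  hE.mono fun δ hδ ↦ hδ.mono fun _ hn ↦ Slicing.interval_shift n (h δ) hn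

lemma limitPhase_le_eventualInterval (φ : ℝ) :
    limitPhase σ φ ≤ eventualInterval σ fun δ ↦ Set.Icc (φ - δ) (φ + δ) := by
  rintro E (hE | ⟨hE, hE'⟩)
  · exact ObjectProperty.prop_of_isZero _ hE
  · filter_upwards [self_mem_nhdsWithin] with δ (hδ : 0 < δ)
    filter_upwards [hE.eventually_le_const (lt_add_of_pos_right φ hδ),
      hE'.eventually_const_le (sub_lt_self φ hδ)] with n hn hn'
    exact Slicing.interval_mono (Set.Icc_subset_Icc hn' hn) _
      ((σ n).slicing.interval_Icc_phiMinus_phiPlus E)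

lemma limitHeart_le_eventualInterval :
    limitHeart σ ≤ eventualInterval σ fun δ ↦ Set.Icc (2 * δ) (1 + δ) := by
  rintro E ⟨F, hF⟩
  refine F.prop fun i ↦ ?_
  filter_upwards [limitPhase_le_eventualInterval _ _ (F.mem i),
    Ioo_mem_nhdsGT (show 0 < F.phase i / 3 by linarith [(hF i).1])] with δ h hδ
  exact h.mono fun n hn ↦ Slicing.interval_mono
    (Set.Icc_subset_Icc (by linarith [hδ.2]) (by linarith [(hF i).2])) _ hn

lemma eventualInterval_of_isLE_of_isGE {t : TStructure C} (hA : t.heart = limitHeart σ)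
    {X : C} {k : ℤ} (hX : t.IsLE X k) (hX' : t.IsGE X k) :
    eventualInterval σ (fun δ ↦ Set.Icc (2 * δ - k) (1 + δ - k)) X := by
  have h := limitHeart_le_eventualInterval _ (hA ▸ heart_shift_of_isLE_of_isGE hX hX')
  refine ObjectProperty.prop_of_iso _ (shiftShiftNeg X k)
    (eventualInterval_shift (-k) (fun δ x hx ↦ ?_) h)
  rw [Int.cast_neg, ← sub_eq_add_neg]
  exact ⟨sub_le_sub_right hx.1 _, sub_le_sub_right hx.2 _⟩

end EventualInterval

section Bounds

lemma massless_of_eventually_le {E : C} {c : ℝ} (hc : 0 < c) {f : ℕ → ℝ}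
    (hf : Tendsto f atTop (𝓝 0)) (h : ∀ᶠ n in atTop, c * (σ n).mass E ≤ f n) :
    massless σ E := by
  refine squeeze_zero' (Eventually.of_forall fun n ↦ (σ n).mass_nonneg E)
    (h.mono fun n hn ↦ (le_div_iff₀' hc).2 hn) ?_
  simpa using hf.div_const c

lemma sin_pi_mul_pos {x : ℝ} (h₀ : 0 < x) (h₁ : x < 1) : 0 < Real.sin (Real.pi * x) :=
  Real.sin_pos_of_pos_of_lt_pi (mul_pos Real.pi_pos h₀) (mul_lt_of_lt_one_right Real.pi_pos h₁)

lemma massless_of_isExtension_of_limitHeart {E F G : C} (h : IsExtension E F G)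
    (hE : limitHeart σ E) (hG : limitHeart σ G) (hF : massless σ F) :
    massless σ E ∧ massless σ G := by
  obtain ⟨δ, ⟨hE, hG⟩, hδ₀, hδ₁⟩ := (((limitHeart_le_eventualInterval _ hE).and
    (limitHeart_le_eventualInterval _ hG)).and (Ioo_mem_nhdsGT one_pos)).exists
  have hc : 0 < Real.sin (Real.pi * (δ / 2)) := sin_pi_mul_pos (by linarith) (by linarith)
  -- Rotating by `3δ/2` moves the phases of `E` and `G` into `[δ/2, 1 - δ/2]`, off `0` and `1`.
  have rotated (n : ℕ) (X : C) (hX : (σ n).slicing.interval (Set.Icc (2 * δ) (1 + δ)) X) :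
      Real.sin (Real.pi * (δ / 2)) * (σ n).mass X ≤ (σ n).rotatedIm (3 / 2 * δ) (classOf X) :=
    (σ n).sin_mul_mass_le_rotatedIm_classOf (by linarith) (Slicing.interval_mono
      (Set.Icc_subset_Icc (by linarith) (by linarith)) _ hX)
  have bound : ∀ᶠ n in atTop,
      Real.sin (Real.pi * (δ / 2)) * ((σ n).mass E + (σ n).mass G) ≤ (σ n).mass F := by
    filter_upwards [hE, hG] with n hE hG
    calc Real.sin (Real.pi * (δ / 2)) * ((σ n).mass E + (σ n).mass G)
      _ ≤ (σ n).rotatedIm (3 / 2 * δ) (classOf E) + (σ n).rotatedIm (3 / 2 * δ) (classOf G) := by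
          rw [mul_add]
          exact add_le_add (rotated n E hE) (rotated n G hG)
      _ = (σ n).rotatedIm (3 / 2 * δ) (classOf F) := by rw [h.classOf_eq_add, map_add]
      _ ≤ (σ n).mass F := (σ n).rotatedIm_classOf_le_mass _ F
  constructor <;> refine massless_of_eventually_le hc hF (bound.mono fun n hn ↦ ?_)
  · nlinarith [(σ n).mass_nonneg G]
  · nlinarith [(σ n).mass_nonneg E]

variable [IsTriangulated C]

lemma massless_of_isExtension {E F G : C} (h : IsExtension E F G) (hE : massless σ E)
    (hG : massless σ G) : massless σ F := by
  refine massless_of_eventually_le one_pos (f := fun n ↦ 2 * ((σ n).mass E + (σ n).mass G)) ?_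
    (.of_forall fun n ↦ by simpa using (σ n).mass_le_two_mul_add h)
  simpa using (Tendsto.add hE hG).const_mul 2

lemma massless_shift {E : C} (hE : massless σ E) (n : ℤ) : massless σ (E⟦n⟧) :=
  massless_of_eventually_le one_pos (by simpa using Tendsto.const_mul 2 hE)
    (.of_forall fun k ↦ by simpa using (σ k).mass_shift_le E n)

lemma massless_left_of_eventualInterval {E F G : C} (h : IsExtension E F G)
    (hE : eventualInterval σ Set.Ioi E) (hG : eventualInterval σ Set.Iic G)
    (hF : massless σ F) : massless σ E := by
  obtain ⟨b, hE, hb₀, hb₁⟩ := (hE.and (Ioo_mem_nhdsGT one_pos)).exists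
  obtain ⟨a, hG, ha₀, hab⟩ := (hG.and (Ioo_mem_nhdsGT hb₀)).exists
  refine massless_of_eventually_le (c := |Real.sin (Real.pi * (b - a))|)
    (abs_pos.2 (sin_pi_mul_pos (by linarith) (by linarith)).ne')
    (by simpa using Tendsto.const_mul 2 hF) ?_
  filter_upwards [hE, hG] with n hE hG
  exact (σ n).mass_left_le hab.le h hE hG

end Bounds

lemma massless_of_isZero {E : C} (hE : IsZero E) : massless σ E := by
  simp only [massless, StabilityCondition.mass_eq_zero_of_isZero _ hE]
  exact tendsto_const_nhds

instance : (massless σ).ContainsZero :=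
  ⟨⟨0, isZero_zero C, massless_of_isZero (isZero_zero C)⟩⟩

variable [IsTriangulated C]

instance : (massless σ).IsClosedUnderIsomorphisms where
  of_iso e h := massless_of_isExtension (.of_isZero_right (isZero_zero C) e) h
    (massless_of_isZero (isZero_zero C))

instance isTriangulated_massless : (massless σ).IsTriangulated where
  isStableUnderShiftBy n := ⟨fun _ hX ↦ massless_shift hX n⟩
  toIsTriangulatedClosed₂ := .mk' fun _ hT h₁ h₃ ↦
    massless_of_isExtension (.of_distTriang hT) h₁ h₃

section Truncation

variable {t : TStructure C} (hA : t.heart = limitHeart σ) (ht : IsBoundedTStructure t)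

include ht hA

lemma eventualInterval_Ioi_of_isLE {X : C} (hX : t.IsLE X 0) : eventualInterval σ Set.Ioi X := by
  obtain ⟨a, ha⟩ := (ht X).1
  refine prop_of_isGE_of_isLE (fun k _ hk Z hZ hZ' ↦ ?_) ha hX
  filter_upwards [eventualInterval_of_isLE_of_isGE hA hZ hZ', self_mem_nhdsWithin]
    with δ h (hδ : 0 < δ)
  have hk : (k : ℝ) ≤ 0 := by exact_mod_cast hk
  exact h.mono fun n hn ↦ Slicing.interval_mono (fun x hx ↦ show δ < x by linarith [hx.1]) _ hn

lemma eventualInterval_Iic_of_isGE {X : C} (hX : t.IsGE X 1) : eventualInterval σ Set.Iic X := by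
  obtain ⟨b, hb⟩ := (ht X).2
  refine prop_of_isGE_of_isLE (fun k hk _ Z hZ hZ' ↦ ?_) hX hb
  have hk : (1 : ℝ) ≤ k := by exact_mod_cast hk
  exact eventualInterval_mono (fun δ x hx ↦ show x ≤ δ by linarith [hx.2]) _
    (eventualInterval_of_isLE_of_isGE hA hZ hZ')

lemma massless_of_isLE_of_isGE {X Y Z : C} (h : IsExtension X Y Z) (hX : t.IsLE X 0)
    (hZ : t.IsGE Z 1) (hY : massless σ Y) : massless σ X :=
  massless_left_of_eventualInterval h (eventualInterval_Ioi_of_isLE hA ht hX)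
    (eventualInterval_Iic_of_isGE hA ht hZ) hY

end Truncation

end Massless

section VerdierQuotient

variable (t : TStructure C) (K : ObjectProperty C) [K.IsTriangulated]

/-- The condition for `t` to descend to `C/K`: the truncations for `t` preserve `K`, and so do
subobjects in the heart. Closure under quotients in the heart follows, `K` being triangulated. -/
structure IsCompatible : Prop where
  truncation {X Y Z : C} : IsExtension X Y Z → t.IsLE X 0 → t.IsGE Z 1 → K Y → K X
  subobject {X Y Z : C} : IsExtension X Y Z → t.heart X → t.heart Z → K Y → K X

variable {t K}

lemma IsExtension.map_verdierQuotient [IsTriangulated C] {X Y Z : C} (h : IsExtension X Y Z) :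
    IsExtension (K.trW.Q.obj X) (K.trW.Q.obj Y) (K.trW.Q.obj Z) :=
  let ⟨_, _, _, hT⟩ := h
  .of_distTriang (K.trW.Q.map_distinguished _ hT)

variable [K.IsClosedUnderIsomorphisms]

lemma prop_of_shift {X : C} (n : ℤ) (h : K (X⟦n⟧)) : K X :=
  K.prop_of_iso (shiftShiftNeg X n) (K.le_shift (-n) _ h)

lemma IsExtension.prop_mid {X Y Z : C} (h : IsExtension X Y Z) (hX : K X) (hZ : K Z) : K Y :=
  let ⟨_, _, _, hT⟩ := h
  K.ext_of_isTriangulatedClosed₂ _ hT hX hZ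

lemma IsExtension.prop_right {X Y Z : C} (h : IsExtension X Y Z) (hX : K X) (hY : K Y) : K Z :=
  let ⟨_, _, _, hT⟩ := h
  K.ext_of_isTriangulatedClosed₃ _ hT hX hY

namespace IsCompatible

variable (hK : IsCompatible t K)

include hK

lemma prop_truncLT {X : C} (n : ℤ) (hX : K X) : K ((t.truncLT n).obj X) :=
  prop_of_shift (n - 1) (hK.truncation ((isExtension_trunc t X n).shift (n - 1))
    (t.isLE_shift _ (n - 1) (n - 1) 0) (t.isGE_shift _ n (n - 1) 1) (K.le_shift _ _ hX))

lemma prop_truncGE {X : C} (n : ℤ) (hX : K X) : K ((t.truncGE n).obj X) :=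
  (isExtension_trunc t X n).prop_right (hK.prop_truncLT n hX) hX

variable [IsTriangulated C]

/-- The obstruction is the image `I` of the connecting morphism `H⁰(X) ⟶ H¹(U)`, a subobject of
`H¹(U)`. -/
lemma prop_truncGE_of_isExtension {U Y X : C} (h : IsExtension U Y X) (hU : K U)
    (hX : t.IsLE X 0) : K ((t.truncGE 1).obj Y) := by
  obtain ⟨D, hYD, hUD⟩ := (isExtension_trunc t U 1).exists_cone_comp h
  obtain ⟨e⟩ := hYD.nonempty_truncGE_iso_of_isLE_left (t.isLE_truncLT_obj U 1 (1 - 1))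
  obtain ⟨I, (hI : t.IsLE I 0), (hI' : t.IsGE I 0), -, hUI⟩ :=
    hUD.exists_image_connecting (n := 1) inferInstance hX
  have hI₁ : t.IsLE (I⟦(-1 : ℤ)⟧) (2 - 1) := t.isLE_shift I 0 (-1) (2 - 1)
  have hHI := hUI.invRotate.truncLT_of_isLE_left (n := 2) hI₁
  have heart_shift {A : C} (hA : t.IsLE A 1) (hA' : t.IsGE A 1) : t.heart (A⟦(1 : ℤ)⟧) :=
    (t.mem_heart_iff _).2 ⟨t.isLE_shift A 1 1 0, t.isGE_shift A 1 1 0⟩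
  have hKI : K (I⟦(-1 : ℤ)⟧⟦(1 : ℤ)⟧) := hK.subobject (hHI.shift 1)
    (heart_shift hI₁ (t.isGE_shift I 0 (-1) 1))
    (heart_shift (t.isLE_truncLT_obj _ 2 1) inferInstance)
    (K.le_shift 1 _ (hK.prop_truncLT 2 (hK.prop_truncGE 1 hU)))
  exact K.prop_of_iso e (hUI.prop_mid (hK.prop_truncGE 1 hU)
    (prop_of_shift (-1) (prop_of_shift 1 hKI)))

lemma verdierQuotient_hom_eq_zero {X Y : C} (hX : t.IsLE X 0) (hY : t.IsGE Y 1)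
    (f : K.trW.Q.obj X ⟶ K.trW.Q.obj Y) : f = 0 := by
  obtain ⟨φ, rfl⟩ := Localization.exists_rightFraction K.trW.Q K.trW f
  obtain ⟨U, a, b, hT, hU⟩ := (K.trW_iff' φ.s).1 φ.hs
  -- The roof `X ⟵ X' ⟶ Y` can be replaced by one whose apex `τ<1 X'` is in degrees `≤ 0`.
  let ι := (t.truncLTι 1).app φ.X'
  have : IsIso (K.trW.Q.map ι) := Localization.inverts K.trW.Q K.trW ι
    ⟨_, _, _, t.triangleLTGE_distinguished 1 φ.X',
      hK.prop_truncGE_of_isExtension (.of_distTriang hT) hU hX⟩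
  have h : K.trW.Q.map φ.f = 0 := by
    rw [← cancel_epi (K.trW.Q.map ι), ← Functor.map_comp,
      t.zero_of_isLE_of_isGE (ι ≫ φ.f) 0 1 (by lia) (t.isLE_truncLT_obj _ _ _) hY,
      Functor.map_zero, comp_zero]
  rw [MorphismProperty.RightFraction.map, h, comp_zero]

/-- The t-structure on `C/K` given by the essential images of the subcategories defining `t`. -/
noncomputable def quotientTStructure : TStructure (VerdierQuotient K) where
  le n := (t.le n).map K.trW.Q
  ge n := (t.ge n).map K.trW.Q
  le_shift n a n' h Z hZ := by
    obtain ⟨X, hX, ⟨e⟩⟩ := (ObjectProperty.prop_map_iff _ _ _).1 hZ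
    exact (ObjectProperty.prop_map_iff _ _ _).2 ⟨_, t.le_shift n a n' h X hX,
      ⟨(K.trW.Q.commShiftIso a).app X ≪≫ (shiftFunctor _ a).mapIso e⟩⟩
  ge_shift n a n' h Z hZ := by
    obtain ⟨X, hX, ⟨e⟩⟩ := (ObjectProperty.prop_map_iff _ _ _).1 hZ
    exact (ObjectProperty.prop_map_iff _ _ _).2 ⟨_, t.ge_shift n a n' h X hX,
      ⟨(K.trW.Q.commShiftIso a).app X ≪≫ (shiftFunctor _ a).mapIso e⟩⟩
  zero' A B f hA hB := by
    obtain ⟨X, hX, ⟨e⟩⟩ := (ObjectProperty.prop_map_iff _ _ _).1 hA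
    obtain ⟨Y, hY, ⟨e'⟩⟩ := (ObjectProperty.prop_map_iff _ _ _).1 hB
    rw [← cancel_epi e.hom, ← cancel_mono e'.inv, comp_zero, zero_comp]
    exact hK.verdierQuotient_hom_eq_zero ⟨hX⟩ ⟨hY⟩ _
  le_zero_le := ObjectProperty.map_monotone t.le_zero_le _
  ge_one_le := ObjectProperty.map_monotone t.ge_one_le _
  exists_triangle_zero_one A := by
    have := Localization.essSurj K.trW.Q K.trW
    obtain ⟨X, Y, hX, hY, h⟩ := t.exists_triangle_zero_one (K.trW.Q.objPreimage A)
    obtain ⟨f, g, h, hT⟩ := (IsExtension.map_verdierQuotient (K := K) h).congr (Iso.refl _)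
      (K.trW.Q.objObjPreimageIso A) (Iso.refl _)
    exact ⟨_, _, ObjectProperty.prop_map_obj _ _ hX, ObjectProperty.prop_map_obj _ _ hY,
      f, g, h, hT⟩

lemma descendsTo_quotientTStructure : DescendsTo t K hK.quotientTStructure :=
  fun _ ↦ ⟨rfl, rfl⟩

lemma isLE_quotientTStructure {X : C} {n : ℤ} (hX : t.IsLE X n) :
    hK.quotientTStructure.IsLE (K.trW.Q.obj X) n :=
  ⟨ObjectProperty.prop_map_obj _ _ hX.le⟩

lemma isGE_quotientTStructure {X : C} {n : ℤ} (hX : t.IsGE X n) :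
    hK.quotientTStructure.IsGE (K.trW.Q.obj X) n :=
  ⟨ObjectProperty.prop_map_obj _ _ hX.ge⟩

lemma isBoundedTStructure_quotientTStructure (ht : IsBoundedTStructure t) :
    IsBoundedTStructure hK.quotientTStructure := fun A ↦ by
  have := Localization.essSurj K.trW.Q K.trW
  obtain ⟨⟨a, ha⟩, ⟨b, hb⟩⟩ := ht (K.trW.Q.objPreimage A)
  exact hK.quotientTStructure.bounded.prop_of_iso (K.trW.Q.objObjPreimageIso A)
    ⟨⟨a, hK.isGE_quotientTStructure ha⟩, ⟨b, hK.isLE_quotientTStructure hb⟩⟩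

lemma heart_quotientTStructure : hK.quotientTStructure.heart = t.heart.map K.trW.Q := by
  ext A
  rw [ObjectProperty.prop_map_iff]
  constructor
  · rintro ⟨hLE, hGE⟩
    obtain ⟨X, hX, ⟨e⟩⟩ := (ObjectProperty.prop_map_iff _ _ _).1 hLE
    have hX' : t.IsLE X 0 := ⟨hX⟩
    have hT := IsExtension.map_verdierQuotient (K := K) (isExtension_trunc t X 0)
    have hQX : hK.quotientTStructure.IsGE (K.trW.Q.obj X) 0 :=
      ⟨ObjectProperty.prop_of_iso _ e.symm hGE⟩
    have hQLE := hK.isLE_quotientTStructure (t.isLE_truncLT_obj X 0 (-1))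
    have hQGE := hT.isGE_left hQX (hK.isGE_quotientTStructure (t.isGE_truncGE_obj X 0 (0 - 1)))
    obtain ⟨e'⟩ := hT.nonempty_iso_of_isZero_left
      (hK.quotientTStructure.isZero _ (-1) 0 (by lia))
    exact ⟨(t.truncGE 0).obj X, (t.mem_heart_iff _).2 ⟨inferInstance, inferInstance⟩,
      ⟨e'.symm ≪≫ e⟩⟩
  · rintro ⟨X, hX, ⟨e⟩⟩
    exact ⟨(ObjectProperty.prop_map_iff _ _ _).2 ⟨X, hX.1, ⟨e⟩⟩,
      (ObjectProperty.prop_map_iff _ _ _).2 ⟨X, hX.2, ⟨e⟩⟩⟩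

end IsCompatible

end VerdierQuotient

section Hearts

variable {t : TStructure C}

lemma heart_isExtension {X Y Z : C} (h : IsExtension X Y Z) (hX : t.heart X) (hZ : t.heart Z) :
    t.heart Y := by
  rw [t.mem_heart_iff] at *
  exact ⟨h.isLE_mid hX.1 hZ.1, h.isGE_mid hX.2 hZ.2⟩

lemma heart_of_isZero {X : C} (hX : IsZero X) : t.heart X :=
  (t.mem_heart_iff _).2 ⟨t.isLE_of_isZero hX 0, t.isGE_of_isZero hX 0⟩

instance : t.heart.ContainsZero := ⟨0, isZero_zero C, heart_of_isZero (isZero_zero C)⟩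

instance : t.heart.IsClosedUnderBinaryProducts where
  limitsOfShape_le := by
    rintro X ⟨p⟩
    refine t.heart.prop_of_iso ?_ (heart_isExtension (.of_distTriang
      (binaryProductTriangle_distinguished _ _)) (p.prop_diag_obj (.mk .left))
      (p.prop_diag_obj (.mk .right)))
    exact IsLimit.conePointUniqueUpToIso (prodIsProd _ _)
      ((IsLimit.postcomposeHomEquiv (diagramIsoPair p.diag) _).2 p.isLimit)

instance : t.heart.IsClosedUnderFiniteProducts := .mk'

lemma heart_hom_shift_eq_zero ⦃X Y : t.heart.FullSubcategory⦄ ⦃n : ℤ⦄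
    (f : t.heart.ι.obj X ⟶ (t.heart.ι.obj Y)⟦n⟧) (hn : n < 0) : f = 0 :=
  t.zero_of_isLE_of_isGE f 0 (-n) (by lia) ⟨X.property.1⟩
    (have : t.IsGE Y.obj 0 := ⟨Y.property.2⟩
     t.isGE_shift Y.obj 0 n (-n))

variable [IsTriangulated C]

/-- The cone `X₃` of a morphism in the heart lives in degrees `-1` and `0`; its truncations there
are the kernel and the cokernel. -/
lemma heart_admissibleMorphism_eq_top :
    AbelianSubcategory.admissibleMorphism t.heart.ι = ⊤ := by
  refine top_unique fun X Y f _ X₃ f₂ f₃ hT ↦ ?_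
  have h : IsExtension Y.obj X₃ (X.obj⟦(1 : ℤ)⟧) := ⟨_, _, _, rot_of_distTriang _ hT⟩
  obtain ⟨hX, hX'⟩ := (t.mem_heart_iff _).1 X.property
  obtain ⟨hY, hY'⟩ := (t.mem_heart_iff _).1 Y.property
  have hX₃ : t.IsLE X₃ 0 := h.isLE_mid hY
    (have := t.isLE_shift X.obj 0 1 (-1); t.isLE_of_le _ (-1) 0)
  have hX₃' : t.IsGE X₃ (-1) := h.isGE_mid (t.isGE_of_ge _ (-1) 0) (t.isGE_shift _ 0 1 (-1))
  have : t.IsLE ((t.truncLT 0).obj X₃) (-1) := t.isLE_truncLT_obj _ _ _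
  have hker : t.heart (((t.truncLT 0).obj X₃)⟦(-1 : ℤ)⟧) := (t.mem_heart_iff _).2
    ⟨t.isLE_shift _ (-1) (-1) 0, t.isGE_shift _ (-1) (-1) 0⟩
  have hcoker : t.heart ((t.truncGE 0).obj X₃) := (t.mem_heart_iff _).2
    ⟨inferInstance, inferInstance⟩
  obtain ⟨α, β, γ, hT'⟩ := (isExtension_trunc t X₃ 0).congr
    (shiftNegShift ((t.truncLT 0).obj X₃) (1 : ℤ)).symm (Iso.refl _) (Iso.refl _)
  exact ⟨⟨_, hker⟩, ⟨_, hcoker⟩, α, β, γ, hT'⟩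

variable (t) in
/-- The abelian category structure on the heart of a t-structure. -/
@[reducible]
noncomputable def abelianHeart : Abelian t.heart.FullSubcategory :=
  AbelianSubcategory.abelian t.heart.ι heart_hom_shift_eq_zero heart_admissibleMorphism_eq_top

attribute [local instance] abelianHeart

lemma isExtension_of_shortExact {S : ShortComplex t.heart.FullSubcategory} (hS : S.ShortExact) :
    IsExtension S.X₁.obj S.X₂.obj S.X₃.obj := by
  have := hS.epi_g
  obtain ⟨I, i, δ, hT⟩ := AbelianSubcategory.exists_distinguished_triangle_of_epi
    heart_hom_shift_eq_zero heart_admissibleMorphism_eq_top S.g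
  let e := IsLimit.conePointUniqueUpToIso
    (AbelianSubcategory.isLimitKernelForkOfDistTriang heart_hom_shift_eq_zero _ _ _ hT)
    hS.fIsKernel
  exact IsExtension.congr ⟨_, _, _, hT⟩ (t.heart.ι.mapIso e) (Iso.refl _) (Iso.refl _)

lemma isSerreClass_inverseImage_heart {K : ObjectProperty C} [K.IsTriangulated]
    [K.IsClosedUnderIsomorphisms]
    (hK : ∀ {X Y Z : C}, IsExtension X Y Z → t.heart X → t.heart Z → K Y → K X) :
    (K.inverseImage t.heart.ι).IsSerreClass := by
  have ends {S : ShortComplex t.heart.FullSubcategory} (hS : S.ShortExact) (h : K S.X₂.obj) :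
      K S.X₁.obj ∧ K S.X₃.obj := by
    have hT := isExtension_of_shortExact hS
    have hX := hK hT S.X₁.property S.X₃.property h
    exact ⟨hX, hT.prop_right hX h⟩
  exact
    { exists_zero := by
        obtain ⟨Z, hZ, hKZ⟩ := K.exists_prop_of_containsZero
        exact ⟨⟨Z, heart_of_isZero hZ⟩, (IsZero.iff_id_eq_zero _).2
          (t.heart.ι.map_injective (hZ.eq_of_src _ _)), hKZ⟩
      prop_of_mono f hf hY :=
        (ends (S := .mk f (cokernel.π f) (cokernel.condition f))
          { exact := ShortComplex.exact_cokernel f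
            mono_f := hf
            epi_g := inferInstance } hY).1
      prop_of_epi f hf hX :=
        (ends (S := .mk (kernel.ι f) f (kernel.condition f))
          { exact := ShortComplex.exact_kernel f
            mono_f := inferInstance
            epi_g := hf } hX).2
      prop_X₂_of_shortExact hS h₁ h₃ := (isExtension_of_shortExact hS).prop_mid h₁ h₃ }

end Hearts

end DegStab

theorem mainTheorem4_general
    {C : Type u} [Category.{v} C] [Preadditive C] [HasZeroObject C] [HasShift C ℤ]
    [∀ n : ℤ, (shiftFunctor C n).Additive] [Pretriangulated C] [IsTriangulated C]
    {Λ : Type w} [AddCommGroup Λ]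
    (p : DegStab.GrothendieckGroup C →+ Λ) (σ : ℕ → DegStab.StabilityCondition p) :
    (∀ T ∈ distTriang C, DegStab.limitHeart σ T.obj₁ → DegStab.limitHeart σ T.obj₃ →
      (DegStab.massless σ T.obj₂ ↔ DegStab.massless σ T.obj₁ ∧ DegStab.massless σ T.obj₃)) ∧
    ((∃ S : DegStab.Slicing C, S.P = DegStab.limitPhase σ) →
      ∃ t : TStructure C, DegStab.IsBoundedTStructure t ∧ t.heart = DegStab.limitHeart σ) ∧
    ∃ _ : (DegStab.massless σ).IsTriangulated,
      ∀ t : TStructure C, DegStab.IsBoundedTStructure t → t.heart = DegStab.limitHeart σ →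
        (∃ _ : Abelian (DegStab.limitHeart σ).FullSubcategory,
          ((DegStab.massless σ).inverseImage (DegStab.limitHeart σ).ι).IsSerreClass) ∧
        ∃ t' : TStructure (DegStab.VerdierQuotient (DegStab.massless σ)),
          DegStab.DescendsTo t (DegStab.massless σ) t' ∧
          DegStab.IsBoundedTStructure t' ∧
          t'.heart = (DegStab.limitHeart σ).map (DegStab.massless σ).trW.Q := by
  refine ⟨fun T hT h₁ h₃ ↦ ⟨DegStab.massless_of_isExtension_of_limitHeart (.of_distTriang hT) h₁ h₃,
    fun h ↦ DegStab.massless_of_isExtension (.of_distTriang hT) h.1 h.2⟩, ?_,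
    DegStab.isTriangulated_massless, fun t ht hA ↦ ?_⟩
  · rintro ⟨S, hS⟩
    refine ⟨S.tStructure 0, S.isBoundedTStructure 0, ?_⟩
    rw [S.heart_tStructure, DegStab.limitHeart, hS, zero_add]
  · have hK : DegStab.IsCompatible t (DegStab.massless σ) :=
      ⟨DegStab.massless_of_isLE_of_isGE hA ht, fun h h₁ h₃ h₂ ↦
        (DegStab.massless_of_isExtension_of_limitHeart h (hA ▸ h₁) (hA ▸ h₃) h₂).1⟩
    refine ⟨?_, hK.quotientTStructure, hK.descendsTo_quotientTStructure,
      hK.isBoundedTStructure_quotientTStructure ht, hK.heart_quotientTStructure.trans (by rw [hA])⟩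
    have serre := DegStab.isSerreClass_inverseImage_heart hK.subobject
    rw [← hA]
    exact ⟨DegStab.abelianHeart t, serre⟩

theorem mainTheorem4
    {C : Type u} [Category.{v} C] [Preadditive C] [HasZeroObject C] [HasShift C ℤ]
    [∀ n : ℤ, (shiftFunctor C n).Additive] [Pretriangulated C] [IsTriangulated C]
    {Λ : Type w} [AddCommGroup Λ] [Module.Free ℤ Λ] [Module.Finite ℤ Λ]
    (p : DegStab.GrothendieckGroup C →+ Λ) (hp : Function.Surjective p)
    (g : InnerProductSpace.Core ℝ (Λ →+ ℂ))
    (σ : ℕ → DegStab.StabilityCondition p) (hσ : DegStab.IsCauchySequence g σ) :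
    (∀ T ∈ distTriang C, DegStab.limitHeart σ T.obj₁ → DegStab.limitHeart σ T.obj₂ →
      DegStab.limitHeart σ T.obj₃ →
      (DegStab.massless σ T.obj₂ ↔ DegStab.massless σ T.obj₁ ∧ DegStab.massless σ T.obj₃)) ∧
    ((∃ S : DegStab.Slicing C, S.P = DegStab.limitPhase σ) →
      ∃ t : TStructure C, DegStab.IsBoundedTStructure t ∧ t.heart = DegStab.limitHeart σ) ∧
    ∃ _ : (DegStab.massless σ).IsTriangulated,
      ∀ t : TStructure C, DegStab.IsBoundedTStructure t → t.heart = DegStab.limitHeart σ →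
        (∃ _ : Abelian (DegStab.limitHeart σ).FullSubcategory,
          ((DegStab.massless σ).inverseImage (DegStab.limitHeart σ).ι).IsSerreClass) ∧
        ∃ t' : TStructure (DegStab.VerdierQuotient (DegStab.massless σ)),
          DegStab.DescendsTo t (DegStab.massless σ) t' ∧
          DegStab.IsBoundedTStructure t' ∧
          t'.heart = (DegStab.limitHeart σ).map (DegStab.massless σ).trW.Q :=
  let ⟨serre, heart, descent⟩ := mainTheorem4_general p σ
  ⟨fun T hT h₁ _ h₃ ↦ serre T hT h₁ h₃, heart, descent⟩
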